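/- Let $n\ge 0$ and let $M$ be an orientable smooth manifold (Hausdorff, second countable, without boundary) of dimension $2n+1$. All tensor fields, metrics and connections below are smooth. The following assertions are equivalent: 1. $M$ admits an almost cosymplectic structure, i.e. a 2-form $\omega$ and a 1-form $\eta$ with $\omega^n\wedge\eta\neq 0$ at every point of $M$. 2. $M$ admits an almost contact structure, i.e. a $(1,1)$-tensor field $\phi$, a vector field $\xi$ and a 1-form $\eta$ with $\eta(\xi)=1$ and $\phi^2=-\mathrm{Id}+\eta\otimes\xi$. 3. There are a Riemannian metric $g$ on $M$ and a pair $(\nabla,\nabla^*)$ of affine connections on $M$ (torsion is allowed) dual with respect to $g$, i.e. $Z(g(X,Y))=g(\nabla_ZX,Y)+g(X,\nabla^*_ZY)$ for all vector fields $X,Y,Z$, such that the gauge equation $$\nabla^*_X(\theta Y)=\theta(\nabla_XY)\qquad\text{for all vector fields }X,Y$$ has a solution $\theta$, a $(1,1)$-tensor field on $M$, which is skew-symmetric, $g(\theta X,Y)=-g(X,\theta Y)$, and has rank $2n$ at every point. -/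

import Mathlib

open Bundle
open scoped Manifold ContDiff

noncomputable section

namespace DualConn

/-- The model space of `m`-dimensional manifolds. -/
abbrev Model (m : ℕ) : Type := EuclideanSpace ℝ (Fin m)

/-- A manifold is orientable if it is covered by smooth charts all of whose transition maps have
positive Jacobian determinant. -/
def Orientable (m : ℕ) (M : Type*) [TopologicalSpace M] [ChartedSpace (Model m) M] : Prop :=
  ∃ A : Set (OpenPartialHomeomorph M (Model m)),
    A ⊆ IsManifold.maximalAtlas (𝓡 m) ∞ M ∧
    (∀ x : M, ∃ e ∈ A, x ∈ e.source) ∧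
    ∀ e ∈ A, ∀ e' ∈ A, ∀ y ∈ (e.symm.trans e').source,
      0 < (fderiv ℝ (e.symm.trans e') y).det

variable (m : ℕ) (M : Type*) [TopologicalSpace M] [ChartedSpace (Model m) M]
  [IsManifold (𝓡 m) ∞ M]

/-- Smooth vector fields. -/
abbrev VectorField : Type _ :=
  ContMDiffSection (𝓡 m) (Model m) ∞ (fun x : M => TangentSpace (𝓡 m) x)

/-- Smooth 1-forms. -/
abbrev OneForm : Type _ :=
  ContMDiffSection (𝓡 m) (Model m →L[ℝ] ℝ) ∞ (fun x : M => TangentSpace (𝓡 m) x →L[ℝ] ℝ)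

/-- Smooth `(0,2)`-tensor fields. -/
abbrev BilinField : Type _ :=
  ContMDiffSection (𝓡 m) (Model m →L[ℝ] Model m →L[ℝ] ℝ) ∞
    (fun x : M => TangentSpace (𝓡 m) x →L[ℝ] TangentSpace (𝓡 m) x →L[ℝ] ℝ)

/-- Smooth 2-forms: alternating `(0,2)`-tensor fields. -/
structure TwoForm where
  /-- the underlying tensor field -/
  toField : BilinField m M
  alt : ∀ (x : M) (v : TangentSpace (𝓡 m) x), toField x v v = 0

/-- Smooth `(1,1)`-tensor fields, i.e. smooth endomorphisms of the tangent bundle. -/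
abbrev EndoField : Type _ :=
  ContMDiffSection (𝓡 m) (Model m →L[ℝ] Model m) ∞
    (fun x : M => TangentSpace (𝓡 m) x →L[ℝ] TangentSpace (𝓡 m) x)

/-- Smooth Riemannian metrics. -/
abbrev Metric : Type _ :=
  ContMDiffRiemannianMetric (𝓡 m) ∞ (Model m) (fun x : M => TangentSpace (𝓡 m) x)

/-- Affine connections on `M`; Mathlib writes `∇ Y x v` for the value at `x` of `∇_v Y`. -/
abbrev Connection : Type _ :=
  CovariantDerivative (𝓡 m) (Model m) (fun x : M => TangentSpace (𝓡 m) x)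

variable {m M}

/-- `∇'` is dual to `∇` with respect to `g`:
`Z (g(X, Y)) = g(∇_Z X, Y) + g(X, ∇'_Z Y)` for all smooth vector fields `X, Y, Z`. -/
def AreDual (g : Metric m M) (nabla nabla' : Connection m M) : Prop :=
  ∀ (X Y Z : VectorField m M) (x : M),
    mvfderiv (𝓡 m) (fun y => g.inner y (X y) (Y y)) x (Z x) =
      g.inner x (nabla X x (Z x)) (Y x) + g.inner x (X x) (nabla' Y x (Z x))

/-- The gauge equation `∇'_X (θ Y) = θ (∇_X Y)` for all smooth vector fields `X, Y`. -/
def GaugeEquation (nabla nabla' : Connection m M) (θ : EndoField m M) : Prop :=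
  ∀ (X Y : VectorField m M) (x : M),
    nabla' (fun y => θ y (Y y)) x (X x) = θ x (nabla Y x (X x))

/-- `θ` is skew-symmetric with respect to `g`. -/
def IsSkew (g : Metric m M) (θ : EndoField m M) : Prop :=
  ∀ (x : M) (v w : TangentSpace (𝓡 m) x), g.inner x (θ x v) w = -g.inner x v (θ x w)

/-- `θ` has rank `r` at every point. -/
def HasConstRank (θ : EndoField m M) (r : ℕ) : Prop :=
  ∀ x : M, Module.finrank ℝ
    (LinearMap.range (θ x : TangentSpace (𝓡 m) x →ₗ[ℝ] TangentSpace (𝓡 m) x)) = r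

/-- The value of the top degree form `Ω ∧ ⋯ ∧ Ω ∧ η` (with `n` factors `Ω`) on a family of
`2 n + 1` vectors, where `Ω` is a 2-form and `η` a 1-form on a vector space:
`2⁻ⁿ ∑_σ sgn(σ) Ω(v_σ(0), v_σ(1)) ⋯ Ω(v_σ(2n-2), v_σ(2n-1)) η(v_σ(2n))`. -/
def wedgePowWedge {V : Type*} (n : ℕ) (Ω : V → V → ℝ) (η : V → ℝ) (v : Fin (2 * n + 1) → V) : ℝ :=
  ((2 : ℝ) ^ n)⁻¹ * ∑ σ : Equiv.Perm (Fin (2 * n + 1)),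
    ((Equiv.Perm.sign σ : ℤ) : ℝ) *
      (∏ i : Fin n, Ω (v (σ ⟨2 * i, by omega⟩)) (v (σ ⟨2 * i + 1, by omega⟩))) *
      η (v (σ (Fin.last (2 * n))))

/-- `(Ω, η)` is an almost cosymplectic structure: `Ω ^ n ∧ η` vanishes at no point. -/
def IsAlmostCosymplectic {n : ℕ} {M : Type*} [TopologicalSpace M]
    [ChartedSpace (Model (2 * n + 1)) M] [IsManifold (𝓡 (2 * n + 1)) ∞ M]
    (Ω : TwoForm (2 * n + 1) M) (η : OneForm (2 * n + 1) M) : Prop :=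
  ∀ x : M, ∃ v : Fin (2 * n + 1) → TangentSpace (𝓡 (2 * n + 1)) x,
    wedgePowWedge n (fun a b => Ω.toField x a b) (fun a => η x a) v ≠ 0

/-- `(φ, ξ, η)` is an almost contact structure: `η(ξ) = 1` and `φ² = -Id + η ⊗ ξ`. -/
def IsAlmostContact (φ : EndoField m M) (ξ : VectorField m M) (η : OneForm m M) : Prop :=
  ∀ x : M, η x (ξ x) = 1 ∧
    ∀ v : TangentSpace (𝓡 m) x, φ x (φ x v) = -v + η x v • ξ x

end DualConn

end

/-! The implications are proved in the cycle 1 → 2 → 3 → 1.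

1 → 2 is a polar decomposition. The form `Ω + η ⊗ η` is nondegenerate, and raising the index of `η`
with it gives the Reeb field `ξ`, with `η ξ = 1` and `Ω(ξ, ·) = 0` (`exists_reeb`). Choose a metric
with `g(ξ, ·) = η` and write `Ω = g(A ·, ·)`. Then `Q = η ⊗ ξ - A²` is symmetric and positive and
commutes with `A`, so `φ = A Q^(-1/2)` satisfies `φ² = -Id + η ⊗ ξ` (`polar_sq`). The analytic point
is that the positive square root depends smoothly on the base point (`smoothEndoAt_sqrt`). It
follows from the inverse function theorem for squaring, and both the invertibility of the derivative
and the uniqueness of the positive root come from the Sylvester equation (`eq_zero_of_sylvester`).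

2 → 3 is an averaging argument. Take a metric for which `φ` is skew and `g(ξ, ·) = η`, and any dual
pair `D, D'`, glued from local flat connections (`exists_dual_connections`). On `ker η`, where `φ⁻¹
= -φ`, the gauge equation asks that the second connection be the conjugate of the first by `φ`. With
`P = -φ²` the projection onto `ker η`, the average `(P D P - φ D' φ) / 2`, completed by `d(η ·) ⊗
ξ`, and its mirror image with `D` and `D'` exchanged solve the gauge equation with `θ = φ` and
remain dual.

3 → 1 uses the orientation. A skew `θ` of rank `2n` gives the 2-form `Ω = g(θ ·, ·)`, and `Ω ^ n ∧
η` evaluated on a frame is `η` of a vector depending only on `Ω` and the frame (`pfaffianVector`).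
This vector is nonzero on every frame, and changing the frame multiplies it by a determinant. Hence
the 1-forms positive on it for all positive frames form a convex condition, solvable locally and
therefore globally by a partition of unity (`exists_oneForm_pos`). -/

noncomputable section

namespace DualConn

/-! ### Alternating forms: the top-degree form `Ω ^ n ∧ η`, degeneracy and Darboux bases -/

section LinearAlgebra

variable {V : Type*} [AddCommGroup V] [Module ℝ V]

/-- The product `Ω(v₀, v₁) ⋯ Ω(v₂ₙ₋₂, v₂ₙ₋₁) • v₂ₙ` is linear in each variable. -/
lemma exists_linearMap_pairing_update (n : ℕ) (Ω : V →ₗ[ℝ] V →ₗ[ℝ] ℝ)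
    (v : Fin (2 * n + 1) → V) (j : Fin (2 * n + 1)) :
    ∃ l : V →ₗ[ℝ] V, ∀ z, (∏ i : Fin n, Ω (Function.update v j z ⟨2 * i, by omega⟩)
      (Function.update v j z ⟨2 * i + 1, by omega⟩)) •
        Function.update v j z (Fin.last (2 * n)) = l z := by
  rcases eq_or_ne j (Fin.last (2 * n)) with rfl | hj
  · refine ⟨(∏ i : Fin n, Ω (v ⟨2 * i, by omega⟩) (v ⟨2 * i + 1, by omega⟩)) • LinearMap.id,
      fun z => ?_⟩
    rw [Function.update_self, LinearMap.smul_apply, LinearMap.id_apply]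
    congr 1
    refine Finset.prod_congr rfl fun i _ => ?_
    rw [Function.update_of_ne (by simp [Fin.ext_iff]; omega),
      Function.update_of_ne (by simp [Fin.ext_iff]; omega)]
  · have hj' : (j : ℕ) < 2 * n := by
      have := j.2
      have : (j : ℕ) ≠ 2 * n := fun h => hj (Fin.ext h)
      omega
    -- The variable `j` occurs in a single factor, the one numbered `j / 2`; the parity of `j`
    -- decides in which slot.
    let k : Fin n := ⟨j / 2, by omega⟩
    have hrest : ∀ z, ∀ i ∈ Finset.univ.erase k,
        Ω (Function.update v j z ⟨2 * i, by omega⟩)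
          (Function.update v j z ⟨2 * i + 1, by omega⟩) =
        Ω (v ⟨2 * i, by omega⟩) (v ⟨2 * i + 1, by omega⟩) := fun z i hi => by
      have hik : (i : ℕ) ≠ j / 2 := fun h => (Finset.ne_of_mem_erase hi) (Fin.ext h)
      rw [Function.update_of_ne (by simp [Fin.ext_iff]; omega),
        Function.update_of_ne (by simp [Fin.ext_iff]; omega)]
    obtain ⟨l, hl⟩ : ∃ l : V →ₗ[ℝ] ℝ, ∀ z, Ω (Function.update v j z ⟨2 * k, by omega⟩)
        (Function.update v j z ⟨2 * k + 1, by omega⟩) = l z := by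
      rcases Nat.mod_two_eq_zero_or_one j with h | h
      · have e1 : (⟨2 * k, by omega⟩ : Fin (2 * n + 1)) = j := Fin.ext (by simp [k]; omega)
        have e2 : (⟨2 * k + 1, by omega⟩ : Fin (2 * n + 1)) ≠ j := by
          simp [Fin.ext_iff, k]; omega
        exact ⟨Ω.flip (v ⟨2 * k + 1, by omega⟩), fun z => by
          simp only [e1, Function.update_self, Function.update_of_ne e2, LinearMap.flip_apply]⟩
      · have e1 : (⟨2 * k, by omega⟩ : Fin (2 * n + 1)) ≠ j := by simp [Fin.ext_iff, k]; omega
        have e2 : (⟨2 * k + 1, by omega⟩ : Fin (2 * n + 1)) = j := Fin.ext (by simp [k]; omega)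
        exact ⟨Ω (v ⟨2 * k, by omega⟩), fun z => by
          simp only [e2, Function.update_self, Function.update_of_ne e1]⟩
    refine ⟨l.smulRight ((∏ i ∈ Finset.univ.erase k,
      Ω (v ⟨2 * i, by omega⟩) (v ⟨2 * i + 1, by omega⟩)) • v (Fin.last (2 * n))), fun z => ?_⟩
    rw [← Finset.mul_prod_erase _ _ (Finset.mem_univ k), Finset.prod_congr rfl (hrest z), hl,
      Function.update_of_ne hj.symm, LinearMap.smulRight_apply, smul_smul]

/-- The multilinear map `v ↦ Ω(v₀, v₁) ⋯ Ω(v₂ₙ₋₂, v₂ₙ₋₁) • v₂ₙ`. -/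
def pairingMultilinear (n : ℕ) (Ω : V →ₗ[ℝ] V →ₗ[ℝ] ℝ) :
    MultilinearMap ℝ (fun _ : Fin (2 * n + 1) => V) V where
  toFun v := (∏ i : Fin n, Ω (v ⟨2 * i, by omega⟩) (v ⟨2 * i + 1, by omega⟩)) •
    v (Fin.last (2 * n))
  map_update_add' := by
    intro inst v j x y
    obtain rfl : inst = instDecidableEqFin _ := Subsingleton.elim _ _
    obtain ⟨l, hl⟩ := exists_linearMap_pairing_update n Ω v j
    simp only [hl, map_add]
  map_update_smul' := by
    intro inst v j c x
    obtain rfl : inst = instDecidableEqFin _ := Subsingleton.elim _ _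
    obtain ⟨l, hl⟩ := exists_linearMap_pairing_update n Ω v j
    simp only [hl, map_smul]

/-- The vector-valued alternating map whose pairing with a 1-form `η` is `Ω ^ n ∧ η`. -/
def pfaffianVector (n : ℕ) (Ω : V →ₗ[ℝ] V →ₗ[ℝ] ℝ) : V [⋀^Fin (2 * n + 1)]→ₗ[ℝ] V :=
  ((2 : ℝ) ^ n)⁻¹ • MultilinearMap.alternatization (pairingMultilinear n Ω)

lemma pfaffianVector_apply (n : ℕ) (Ω : V →ₗ[ℝ] V →ₗ[ℝ] ℝ) (v : Fin (2 * n + 1) → V) :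
    pfaffianVector n Ω v = ((2 : ℝ) ^ n)⁻¹ • ∑ σ : Equiv.Perm (Fin (2 * n + 1)),
      (((Equiv.Perm.sign σ : ℤ) : ℝ) *
        ∏ i : Fin n, Ω (v (σ ⟨2 * i, by omega⟩)) (v (σ ⟨2 * i + 1, by omega⟩))) •
          v (σ (Fin.last (2 * n))) := by
  rw [pfaffianVector, AlternatingMap.smul_apply, MultilinearMap.alternatization_apply]
  congr 1
  refine Finset.sum_congr rfl fun σ _ => ?_
  rw [MultilinearMap.domDomCongr_apply, mul_smul]
  simp only [pairingMultilinear, MultilinearMap.coe_mk, Units.smul_def, Int.cast_smul_eq_zsmul]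

lemma wedgePowWedge_eq (n : ℕ) (Ω : V →ₗ[ℝ] V →ₗ[ℝ] ℝ) (η : V →ₗ[ℝ] ℝ)
    (v : Fin (2 * n + 1) → V) :
    wedgePowWedge n (fun a b => Ω a b) (fun a => η a) v = η (pfaffianVector n Ω v) := by
  simp only [wedgePowWedge, pfaffianVector_apply, map_smul, map_sum, smul_eq_mul]

/-- Scalar alternating maps of top degree are multiples of the determinant, and this applies to each
coordinate of the vector-valued map. -/
lemma pfaffianVector_eq_det_smul (n : ℕ) (Ω : V →ₗ[ℝ] V →ₗ[ℝ] ℝ)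
    (b : Module.Basis (Fin (2 * n + 1)) ℝ V) (v : Fin (2 * n + 1) → V) :
    pfaffianVector n Ω v = b.det v • pfaffianVector n Ω b := by
  have : ∀ i, b.coord i (pfaffianVector n Ω v) = b.coord i (b.det v • pfaffianVector n Ω b) := by
    intro i
    have h := ((b.coord i).compAlternatingMap (pfaffianVector n Ω)).eq_smul_basis_det b
    have h' := congrArg (fun f => f v) h
    simp only [LinearMap.compAlternatingMap_apply, AlternatingMap.smul_apply] at h'
    rw [h', map_smul, smul_eq_mul, smul_eq_mul, mul_comm]
  exact b.ext_elem this

/-- If `Ω ^ n ∧ η ≠ 0` then `Ω` and `η` have no common kernel. -/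
lemma eq_zero_of_wedgePowWedge_ne_zero {n : ℕ} (hV : Module.finrank ℝ V = 2 * n + 1)
    {Ω : V →ₗ[ℝ] V →ₗ[ℝ] ℝ} (halt : ∀ v, Ω v v = 0) {η : V →ₗ[ℝ] ℝ} {v : Fin (2 * n + 1) → V}
    (hv : wedgePowWedge n (fun a b => Ω a b) (fun a => η a) v ≠ 0) {u : V}
    (hu : ∀ w, Ω u w = 0) (hηu : η u = 0) : u = 0 := by
  by_contra hne
  have hfd : FiniteDimensional ℝ V := FiniteDimensional.of_finrank_pos (by omega)
  have hanti : ∀ w, Ω w u = 0 := fun w => by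
    have := halt (u + w)
    simp only [map_add, LinearMap.add_apply, halt, hu, zero_add, add_zero] at this
    exact this
  have hs : LinearIndepOn ℝ id ({u} : Set V) := LinearIndepOn.singleton hne
  let B := Module.Basis.extend hs
  have : Fintype (hs.extend (Set.subset_univ {u})) := FiniteDimensional.fintypeBasisIndex B
  have hcard : Fintype.card (hs.extend (Set.subset_univ {u})) = Fintype.card (Fin (2 * n + 1)) := by
    rw [← Module.finrank_eq_card_basis B, hV, Fintype.card_fin]
  let b := B.reindex (Fintype.equivOfCardEq hcard)
  obtain ⟨j, hj⟩ : ∃ j, b j = u := by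
    have : u ∈ hs.extend (Set.subset_univ {u}) :=
      hs.subset_extend (Set.subset_univ {u}) rfl
    exact ⟨Fintype.equivOfCardEq hcard ⟨u, this⟩, by simp [b, B]⟩
  -- A top-degree form is determined by its value on the basis `b`. There each monomial contains `u
  -- = b j` exactly once, either in `η` or in one slot of `Ω`, so every monomial vanishes.
  apply hv
  rw [wedgePowWedge_eq, pfaffianVector_eq_det_smul n Ω b, map_smul, ← wedgePowWedge_eq,
    wedgePowWedge]
  rw [Finset.sum_eq_zero, mul_zero, smul_zero]
  intro σ _
  rcases eq_or_ne (σ.symm j) (Fin.last (2 * n)) with h | h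
  · rw [← h, Equiv.apply_symm_apply, hj, hηu, mul_zero]
  · have hlt : ((σ.symm j : Fin _) : ℕ) < 2 * n := by
      have := (σ.symm j).2
      have : ((σ.symm j : Fin _) : ℕ) ≠ 2 * n := fun h' => h (Fin.ext h')
      omega
    rw [Finset.prod_eq_zero (Finset.mem_univ ⟨(σ.symm j : ℕ) / 2, by omega⟩), mul_zero, zero_mul]
    rcases Nat.mod_two_eq_zero_or_one (σ.symm j : ℕ) with h2 | h2
    · have e : (⟨2 * ((σ.symm j : ℕ) / 2), by omega⟩ : Fin (2 * n + 1)) = σ.symm j :=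
        Fin.ext (by simp; omega)
      simp only [e, Equiv.apply_symm_apply, hj, hu]
    · have e : (⟨2 * ((σ.symm j : ℕ) / 2) + 1, by omega⟩ : Fin (2 * n + 1)) = σ.symm j :=
        Fin.ext (by simp; omega)
      simp only [e, Equiv.apply_symm_apply, hj, hanti]

/-- An alternating form on an odd-dimensional space is degenerate. -/
lemma exists_ne_zero_forall_eq_zero_of_odd {n : ℕ} (hV : Module.finrank ℝ V = 2 * n + 1)
    {Ω : V →ₗ[ℝ] V →ₗ[ℝ] ℝ} (halt : ∀ v, Ω v v = 0) : ∃ u, u ≠ 0 ∧ ∀ w, Ω u w = 0 := by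
  have hfd : FiniteDimensional ℝ V := FiniteDimensional.of_finrank_pos (by omega)
  have hanti : ∀ u w, Ω w u = -Ω u w := fun u w => by
    have := halt (u + w)
    simp only [map_add, LinearMap.add_apply, halt, zero_add, add_zero] at this
    linarith
  let b := Module.finBasisOfFinrankEq ℝ V hV
  let A : Matrix (Fin (2 * n + 1)) (Fin (2 * n + 1)) ℝ := .of fun i j => Ω (b i) (b j)
  have hA : A.transpose = -A := by
    ext i j
    simp [A, hanti (b i) (b j)]
  -- The size is odd, so `det A = det Aᵀ = det (-A) = -det A`.
  have hdet : A.det = 0 := by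
    have h := A.det_transpose
    rw [hA, Matrix.det_neg, Fintype.card_fin, pow_succ, pow_mul] at h
    norm_num at h
    linarith
  obtain ⟨c, hc, hcA⟩ := Matrix.exists_vecMul_eq_zero_iff.2 hdet
  refine ⟨∑ i, c i • b i, fun h => hc ?_, fun w => ?_⟩
  · ext i
    have := congrArg (fun x => b.repr x i) h
    simpa [Module.Basis.repr_self, Finsupp.single_apply] using this
  · have : Ω (∑ i, c i • b i) = 0 := by
      refine b.ext fun j => ?_
      have := congrFun hcA j
      simpa [Matrix.vecMul, dotProduct, A] using this
    rw [this, LinearMap.zero_apply]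

/-- The sign of a Darboux pair. -/
def boolSign (b c : Bool) : ℝ := if b = c then 0 else if b then -1 else 1

/-- Darboux bases of nondegenerate alternating forms. -/
lemma exists_darboux [FiniteDimensional ℝ V] {Ω : V →ₗ[ℝ] V →ₗ[ℝ] ℝ} (halt : ∀ v, Ω v v = 0)
    (n : ℕ) : ∀ W : Submodule ℝ V, Module.finrank ℝ W = 2 * n →
      (∀ u ∈ W, (∀ w ∈ W, Ω u w = 0) → u = 0) →
      ∃ e : Fin n → Bool → V, (∀ i b, e i b ∈ W) ∧
        ∀ i b j c, Ω (e i b) (e j c) = if i = j then boolSign b c else 0 := by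
  have hanti : ∀ u w, Ω w u = -Ω u w := fun u w => by
    have := halt (u + w)
    simp only [map_add, LinearMap.add_apply, halt, zero_add, add_zero] at this
    linarith
  induction n with
  | zero => exact fun W _ _ => ⟨Fin.elim0, fun i => i.elim0, fun i => i.elim0⟩
  | succ n ih =>
    intro W hW hnd
    obtain ⟨u, huW, hu⟩ : ∃ u ∈ W, u ≠ 0 := by
      refine W.exists_mem_ne_zero_of_ne_bot fun h => ?_
      rw [h, finrank_bot] at hW
      omega
    obtain ⟨w, hwW, hw⟩ : ∃ w ∈ W, Ω u w ≠ 0 := by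
      by_contra! h
      exact hu (hnd u huW h)
    set u' := (Ω u w)⁻¹ • w with hu'
    have hu'W : u' ∈ W := W.smul_mem _ hwW
    have huu' : Ω u u' = 1 := by rw [hu', map_smul, smul_eq_mul, inv_mul_cancel₀ hw]
    have hu'u : Ω u' u = -1 := by rw [hanti u u', huu']
    -- The kernel of `L` is the `Ω`-orthogonal complement in `W` of the hyperbolic plane spanned by
    -- `u` and `u'`; the induction continues there.
    let L : W →ₗ[ℝ] ℝ × ℝ := ((Ω u).prod (Ω u')) ∘ₗ W.subtype
    have hL : Function.Surjective L := fun p =>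
      ⟨⟨p.1 • u' - p.2 • u, W.sub_mem (W.smul_mem _ hu'W) (W.smul_mem _ huW)⟩, by
        simp [L, halt, huu', hu'u]⟩
    have hker : Module.finrank ℝ (LinearMap.ker L) = 2 * n := by
      have h := L.finrank_range_add_finrank_ker
      rw [LinearMap.range_eq_top.2 hL, finrank_top, hW] at h
      simp at h
      omega
    let W' : Submodule ℝ V := (LinearMap.ker L).map W.subtype
    have hmem : ∀ x, x ∈ W' ↔ x ∈ W ∧ Ω u x = 0 ∧ Ω u' x = 0 := fun x => by
      simp only [W', L, Submodule.mem_map, LinearMap.mem_ker]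
      constructor
      · rintro ⟨y, hy, rfl⟩
        exact ⟨y.2, by simpa using congrArg Prod.fst hy, by simpa using congrArg Prod.snd hy⟩
      · rintro ⟨hx, h1, h2⟩
        exact ⟨⟨x, hx⟩, Prod.ext (by simpa using h1) (by simpa using h2), rfl⟩
    have hW' : Module.finrank ℝ W' = 2 * n := by
      rw [← hker]
      exact (Submodule.equivMapOfInjective _ W.subtype_injective _).finrank_eq.symm
    obtain ⟨e, heW, he⟩ := ih W' hW' fun x hx hxW' => by
      obtain ⟨hxW, hux, hu'x⟩ := (hmem x).1 hx
      refine hnd x hxW fun y hy => ?_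
      -- The vector is the projection of `y` to that complement along the plane; it pairs with `x`
      -- as `y` does, since `x` is orthogonal to `u` and `u'`.
      have h := hxW' (y - Ω u y • u' + Ω u' y • u) ((hmem _).2
        ⟨W.add_mem (W.sub_mem hy (W.smul_mem _ hu'W)) (W.smul_mem _ huW), by
          simp [halt, huu'], by simp [halt, hu'u]⟩)
      simpa [hanti u x, hanti u' x, hux, hu'x] using h
    refine ⟨Fin.cons (fun b => if b then u' else u) e, fun i b => ?_, fun i b j c => ?_⟩
    · refine Fin.cases ?_ (fun i => ?_) i
      · cases b <;> simp [huW, hu'W]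
      · simpa using ((hmem _).1 (heW i b)).1
    · refine Fin.cases ?_ (fun i => ?_) i <;> refine Fin.cases ?_ (fun j => ?_) j
      · cases b <;> cases c <;> simp [halt, huu', hu'u, boolSign]
      · have := (hmem _).1 (heW j c)
        cases b <;> simp [this.2.1, this.2.2, (Fin.succ_ne_zero _).symm]
      · have := (hmem _).1 (heW i b)
        cases c <;> simp [hanti u, hanti u', this.2.1, this.2.2, Fin.succ_ne_zero]
      · simp [he]

end LinearAlgebra

end DualConn

end

noncomputable section

namespace DualConn

/-! ### Nonvanishing of `Ω ^ n ∧ η` on a Darboux basis -/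

section Pfaffian

lemma boolSign_perm (s : Equiv.Perm Bool) :
    boolSign (s false) (s true) = ((Equiv.Perm.sign s : ℤ) : ℝ) := by
  have h : ∀ s : Equiv.Perm Bool, (s false = false ∧ s true = true ∧ Equiv.Perm.sign s = 1) ∨
    (s false = true ∧ s true = false ∧ Equiv.Perm.sign s = -1) := by decide
  rcases h s with ⟨h1, h2, h3⟩ | ⟨h1, h2, h3⟩ <;> simp [h1, h2, h3, boolSign]

/-- This excludes cancellation in the expansion on a Darboux basis. A term survives only if `σ`
sends pairs to pairs. Such a `σ` permutes the pairs by some `τ`, after swaps `s i` inside them. As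
`τ` acts on two copies of the index set its sign cancels, so the sign of `σ` equals the product of
the Darboux signs and the term is a square. -/
lemma sign_mul_prod_boolSign_nonneg {n : ℕ} (σ : Equiv.Perm (Fin n × Bool)) :
    0 ≤ ((Equiv.Perm.sign σ : ℤ) : ℝ) * ∏ i, if (σ (i, false)).1 = (σ (i, true)).1 then
      boolSign (σ (i, false)).2 (σ (i, true)).2 else 0 := by
  by_cases h : ∀ i, (σ (i, false)).1 = (σ (i, true)).1
  · have hfst : ∀ i b, (σ (i, b)).1 = (σ (i, false)).1 := fun i b => by
      cases b
      · rfl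
      · exact (h i).symm
    have hs : ∀ i, Function.Injective fun b => (σ (i, b)).2 := fun i b c hbc => by
      have : σ (i, b) = σ (i, c) := Prod.ext ((hfst i b).trans (hfst i c).symm) hbc
      simpa using σ.injective this
    let s : Fin n → Equiv.Perm Bool := fun i =>
      Equiv.ofBijective _ (Finite.injective_iff_bijective.1 (hs i))
    have hτ : Function.Surjective fun i => (σ (i, false)).1 := fun j => by
      obtain ⟨⟨i, b⟩, hib⟩ := σ.surjective (j, false)
      exact ⟨i, (hfst i b).symm.trans (congrArg Prod.fst hib)⟩
    let τ : Equiv.Perm (Fin n) := Equiv.ofBijective _ (Finite.surjective_iff_bijective.1 hτ)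
    have hσ : σ = Equiv.prodCongrLeft (fun _ : Bool => τ) * Equiv.prodCongrRight s := by
      ext1 ⟨i, b⟩
      exact Prod.ext (hfst i b) rfl
    have hsign : ((Equiv.Perm.sign σ : ℤ) : ℝ) = ∏ i, ((Equiv.Perm.sign (s i) : ℤ) : ℝ) := by
      rw [hσ, Equiv.Perm.sign_mul, Equiv.Perm.sign_prodCongrLeft, Equiv.Perm.sign_prodCongrRight]
      simp
    rw [hsign, ← Finset.prod_mul_distrib]
    refine Finset.prod_nonneg fun i _ => ?_
    rw [if_pos (h i)]
    have := boolSign_perm (s i)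
    simp only [s, Equiv.ofBijective_apply] at this ⊢
    rw [this]
    exact mul_self_nonneg _
  · push Not at h
    obtain ⟨i, hi⟩ := h
    rw [Finset.prod_eq_zero (Finset.mem_univ i) (if_neg hi), mul_zero]

/-- Pairing up the indices below `2 n`. -/
def pairEquiv (n : ℕ) : Option (Fin n × Bool) ≃ Fin (2 * n + 1) :=
  Equiv.ofBijective
    (fun o => o.elim (Fin.last (2 * n)) fun p => ⟨2 * p.1 + p.2.toNat, by
      have := p.1.2; have := p.2.toNat_lt; omega⟩) <| by
    rw [Fintype.bijective_iff_injective_and_card]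
    refine ⟨?_, by simp; ring⟩
    rintro (_ | ⟨i, b⟩) (_ | ⟨j, c⟩) h
    · rfl
    · have := congrArg Fin.val h
      have := j.2; have := c.toNat_lt
      simp at *; omega
    · have := congrArg Fin.val h
      have := i.2; have := b.toNat_lt
      simp at *; omega
    · have h := congrArg Fin.val h
      have hb := b.toNat_lt; have hc := c.toNat_lt
      simp only [Option.elim_some] at h
      have h1 : i = j := Fin.ext (by omega)
      have h2 : b.toNat = c.toNat := by omega
      rw [h1, show b = c by revert h2; cases b <;> cases c <;> decide]

variable {V : Type*} [AddCommGroup V] [Module ℝ V]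

/-- If `Ω` is nondegenerate on the kernel of `η ≠ 0`, then `Ω ^ n ∧ η ≠ 0`. -/
lemma exists_wedgePowWedge_ne_zero {n : ℕ} (hV : Module.finrank ℝ V = 2 * n + 1)
    {Ω : V →ₗ[ℝ] V →ₗ[ℝ] ℝ} (halt : ∀ v, Ω v v = 0) {η : V →ₗ[ℝ] ℝ} (hη : η ≠ 0)
    (hnd : ∀ u, η u = 0 → (∀ w, η w = 0 → Ω u w = 0) → u = 0) :
    ∃ v : Fin (2 * n + 1) → V, wedgePowWedge n (fun a b => Ω a b) (fun a => η a) v ≠ 0 := by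
  have hfd : FiniteDimensional ℝ V := FiniteDimensional.of_finrank_pos (by omega)
  have hker : Module.finrank ℝ (LinearMap.ker η) = 2 * n := by
    have h := η.finrank_range_add_finrank_ker
    rw [LinearMap.range_eq_top.2 (LinearMap.surjective hη), finrank_top, hV,
      Module.finrank_self] at h
    omega
  obtain ⟨e, heη, he⟩ := exists_darboux halt n (LinearMap.ker η) hker hnd
  obtain ⟨ξ, hξ⟩ := LinearMap.surjective hη 1
  let w : Option (Fin n × Bool) → V := fun o => o.elim ξ fun p => e p.1 p.2
  have h1 : ∀ i : Fin n, (⟨2 * i, by omega⟩ : Fin (2 * n + 1)) = pairEquiv n (some (i, false)) :=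
    fun i => Fin.ext (by simp [pairEquiv])
  have h2 : ∀ i : Fin n,
      (⟨2 * i + 1, by omega⟩ : Fin (2 * n + 1)) = pairEquiv n (some (i, true)) :=
    fun i => Fin.ext (by simp [pairEquiv])
  have h3 : Fin.last (2 * n) = pairEquiv n none := rfl
  refine ⟨fun k => w ((pairEquiv n).symm k), ne_of_gt ?_⟩
  rw [wedgePowWedge]
  refine mul_pos (by positivity) (Finset.sum_pos' (fun σ _ => ?_) ⟨1, Finset.mem_univ _, ?_⟩)
  · obtain ⟨p, rfl⟩ := (pairEquiv n).permCongr.surjective σ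
    simp only [h1, h2, h3, Equiv.permCongr_apply, Equiv.symm_apply_apply,
      Equiv.Perm.sign_permCongr]
    -- A permutation moving the last index feeds a vector of `ker η` to `η` and contributes zero;
    -- one fixing it is a permutation of the Darboux vectors. The identity contributes a positive
    -- term.
    by_cases hp : p none = none
    · have hp' : Equiv.optionCongr (Equiv.removeNone p) = p := by
        ext1 o
        cases o with
        | none => simp [hp]
        | some o =>
          rw [Equiv.optionCongr_apply, Option.map_some]
          refine Equiv.removeNone_some p (Option.ne_none_iff_exists'.1 fun h => ?_)
          exact Option.some_ne_none o (p.injective (h.trans hp.symm))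
      rw [← hp']
      simp only [Equiv.optionCongr_sign, Equiv.optionCongr_apply, Option.map_some,
        Option.map_none, w, Option.elim_some, Option.elim_none, hξ, mul_one, he]
      exact sign_mul_prod_boolSign_nonneg _
    · obtain ⟨q, hq⟩ := Option.ne_none_iff_exists'.1 hp
      rw [hq]
      simp [w, LinearMap.mem_ker.1 (heη q.1 q.2)]
  · simp only [Equiv.Perm.one_apply, h1, h2, h3, Equiv.symm_apply_apply]
    simp [w, he, hξ, boolSign]

end Pfaffian

/-! ### Positive square roots and the Sylvester equation -/

section SquareRoot

variable {V : Type*} [AddCommGroup V] [Module ℝ V] [FiniteDimensional ℝ V]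

/-- Simultaneous diagonalization of a scalar product and a symmetric operator. -/
lemma exists_orthonormal_eigenbasis {g : V →ₗ[ℝ] V →ₗ[ℝ] ℝ} (hsymm : ∀ v w, g v w = g w v)
    (hpos : ∀ v, v ≠ 0 → 0 < g v v) {Q : V →ₗ[ℝ] V} (hQ : ∀ v w, g (Q v) w = g v (Q w)) :
    ∃ (b : Module.Basis (Fin (Module.finrank ℝ V)) ℝ V) (μ : Fin (Module.finrank ℝ V) → ℝ),
      (∀ i j, g (b i) (b j) = if i = j then 1 else 0) ∧ ∀ i, Q (b i) = μ i • b i := by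
  -- The form `g` itself serves as the inner product, which makes the spectral theorem available for
  -- `Q`.
  let core : InnerProductSpace.Core ℝ V :=
    { inner := fun v w => g v w
      conj_inner_symm := fun v w => by simp [hsymm v w]
      re_inner_nonneg := fun v => by
        rcases eq_or_ne v 0 with rfl | hv
        · simp
        · simpa using (hpos v hv).le
      add_left := fun u v w => by simp
      smul_left := fun u v r => by simp
      definite := fun v hv => by
        by_contra h
        exact (hpos v h).ne' hv }
  let _ : NormedAddCommGroup V := core.toNormedAddCommGroup
  let _ : InnerProductSpace ℝ V := InnerProductSpace.ofCore core.toCore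
  have hQs : Q.IsSymmetric := fun v w => hQ v w
  refine ⟨(hQs.eigenvectorBasis rfl).toBasis, hQs.eigenvalues rfl, fun i j => ?_, fun i => ?_⟩
  · have := orthonormal_iff_ite.1 (hQs.eigenvectorBasis rfl).orthonormal i j
    rw [OrthonormalBasis.coe_toBasis]
    exact this
  · rw [OrthonormalBasis.coe_toBasis]
    exact hQs.apply_eigenvectorBasis rfl i

/-- The Sylvester equation `S D + D T = 0` has only the zero solution if `S` is symmetric and
`S`, `T` are positive. -/
lemma eq_zero_of_sylvester {g : V →ₗ[ℝ] V →ₗ[ℝ] ℝ} (hsymm : ∀ v w, g v w = g w v)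
    (hpos : ∀ v, v ≠ 0 → 0 < g v v) {S T D : V →ₗ[ℝ] V} (hS : ∀ v w, g (S v) w = g v (S w))
    (hS' : ∀ v, v ≠ 0 → 0 < g (S v) v) (hT : ∀ v, v ≠ 0 → 0 < g (T v) v)
    (h : ∀ v, S (D v) + D (T v) = 0) : D = 0 := by
  obtain ⟨b, μ, hb, hSb⟩ := exists_orthonormal_eigenbasis hsymm hpos hS
  have hμ : ∀ i, 0 < μ i := fun i => by
    have := hS' (b i) (b.ne_zero i)
    rwa [hSb, map_smul, LinearMap.smul_apply, hb, if_pos rfl, smul_eq_mul, mul_one] at this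
  have hzero : ∀ i w, g (b i) (D w) = 0 := by
    intro i
    -- Here `u` is the `g`-adjoint of `D` applied to the eigenvector `b i`. Pairing the equation at
    -- `u` with `b i` gives `μ i * g u u + g u (T u) = 0`, a sum of two terms that are positive
    -- unless `u = 0`. Symmetry of `T` plays no role.
    let u := ∑ j, g (b i) (D (b j)) • b j
    have hu : ∀ w, g u w = g (b i) (D w) := fun w => by
      have : g u = g (b i) ∘ₗ D := b.ext fun j => by simp [u, hb]
      rw [this, LinearMap.comp_apply]
    have hu0 : u = 0 := by
      by_contra hne
      have h1 : μ i * g u u + g u (T u) = 0 := by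
        have h2 := congrArg (g (b i)) (h u)
        rw [map_add, ← hS, hSb, map_smul, LinearMap.smul_apply, ← hu, ← hu, map_zero] at h2
        exact h2
      have h2 := mul_pos (hμ i) (hpos u hne)
      have h3 := hT u hne
      rw [hsymm] at h3
      linarith
    intro w
    rw [← hu, hu0, map_zero, LinearMap.zero_apply]
  ext w
  by_contra hne
  have h1 : g (D w) = 0 := b.ext fun i => by rw [hsymm, hzero, LinearMap.zero_apply]
  have := hpos (D w) hne
  rw [h1, LinearMap.zero_apply] at this
  exact lt_irrefl _ this

/-- A positive symmetric operator has a positive symmetric square root. -/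
lemma exists_symmetric_sqrt {g : V →ₗ[ℝ] V →ₗ[ℝ] ℝ} (hsymm : ∀ v w, g v w = g w v)
    (hpos : ∀ v, v ≠ 0 → 0 < g v v) {Q : V →ₗ[ℝ] V} (hQ : ∀ v w, g (Q v) w = g v (Q w))
    (hQ' : ∀ v, v ≠ 0 → 0 < g (Q v) v) :
    ∃ S : V →ₗ[ℝ] V, (∀ v w, g (S v) w = g v (S w)) ∧ (∀ v, v ≠ 0 → 0 < g (S v) v) ∧
      ∀ v, S (S v) = Q v := by
  obtain ⟨b, μ, hb, hQb⟩ := exists_orthonormal_eigenbasis hsymm hpos hQ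
  have hμ : ∀ i, 0 < μ i := fun i => by
    have := hQ' (b i) (b.ne_zero i)
    rwa [hQb, map_smul, LinearMap.smul_apply, hb, if_pos rfl, smul_eq_mul, mul_one] at this
  let S : V →ₗ[ℝ] V := b.constr ℝ fun i => √(μ i) • b i
  have hSb : ∀ i, S (b i) = √(μ i) • b i := fun i => b.constr_basis ℝ _ i
  refine ⟨S, fun v w => ?_, fun v hv => ?_, fun v => ?_⟩
  · have : g ∘ₗ S = (LinearMap.lcomp ℝ ℝ S) ∘ₗ g := b.ext fun i => b.ext fun j => by
      simp only [LinearMap.comp_apply, LinearMap.lcomp_apply, hSb, map_smul, LinearMap.smul_apply,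
        hb, smul_eq_mul]
      split_ifs with h
      · rw [h]
      · simp
    exact congrArg (fun f => f v w) this
  · have hv' : v = ∑ i, b.repr v i • b i := (b.sum_repr v).symm
    obtain ⟨j, hj⟩ : ∃ j, b.repr v j ≠ 0 := by
      by_contra! h
      exact hv (by rw [hv']; simp [h])
    have hval : g (S v) v = ∑ i, √(μ i) * (b.repr v i) ^ 2 := by
      conv_lhs => rw [hv']
      simp only [map_sum, map_smul, hSb, LinearMap.sum_apply, LinearMap.smul_apply, hb,
        smul_eq_mul]
      refine Finset.sum_congr rfl fun i _ => ?_
      simp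
      ring
    rw [hval]
    refine Finset.sum_pos' (fun i _ => by positivity) ⟨j, Finset.mem_univ _, ?_⟩
    have := Real.sqrt_pos.2 (hμ j)
    positivity
  · have : S ∘ₗ S = Q := b.ext fun i => by
      rw [LinearMap.comp_apply, hSb, map_smul, hSb, hQb, smul_smul,
        Real.mul_self_sqrt (hμ i).le]
    exact congrArg (fun f => f v) this

end SquareRoot

end DualConn

end

noncomputable section

namespace DualConn

/-! ### Smoothness of sections of bundles of homomorphisms -/

section HomBundle

variable {EB : Type*} [NormedAddCommGroup EB] [NormedSpace ℝ EB] {HB : Type*} [TopologicalSpace HB]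
  {IB : ModelWithCorners ℝ EB HB} {B : Type*} [TopologicalSpace B] [ChartedSpace HB B]
  {F₁ F₂ : Type*} [NormedAddCommGroup F₁] [NormedSpace ℝ F₁] [NormedAddCommGroup F₂]
  [NormedSpace ℝ F₂] {E₁ E₂ : B → Type*}
  [∀ x, AddCommGroup (E₁ x)] [∀ x, Module ℝ (E₁ x)] [TopologicalSpace (TotalSpace F₁ E₁)]
  [∀ x, TopologicalSpace (E₁ x)] [∀ x, AddCommGroup (E₂ x)] [∀ x, Module ℝ (E₂ x)]
  [TopologicalSpace (TotalSpace F₂ E₂)] [∀ x, TopologicalSpace (E₂ x)]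
  [FiberBundle F₁ E₁] [VectorBundle ℝ F₁ E₁] [FiberBundle F₂ E₂] [VectorBundle ℝ F₂ E₂]
  [∀ x, IsTopologicalAddGroup (E₁ x)] [∀ x, ContinuousSMul ℝ (E₁ x)]
  [∀ x, IsTopologicalAddGroup (E₂ x)] [∀ x, ContinuousSMul ℝ (E₂ x)]
  {n : WithTop ℕ∞} {x₀ : B}

/-- A map into a space of linear maps on a finite-dimensional space is smooth if all its
evaluations are. -/
lemma contMDiffAt_clm_of_apply [FiniteDimensional ℝ F₁] {f : B → F₁ →L[ℝ] F₂}
    (h : ∀ v, ContMDiffAt IB 𝓘(ℝ, F₂) n (fun x => f x v) x₀) :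
    ContMDiffAt IB 𝓘(ℝ, F₁ →L[ℝ] F₂) n f x₀ := by
  let b := Module.finBasis ℝ F₁
  have hf : f = fun x => ∑ i, ContinuousLinearMap.smulRightL ℝ F₁ F₂
      (LinearMap.toContinuousLinearMap (b.coord i)) (f x (b i)) := by
    funext x
    ext v
    have hv := congrArg (f x) (b.sum_repr v)
    rw [map_sum] at hv
    simp only [map_smul] at hv
    simp [← hv]
  rw [hf]
  exact contMDiffAt_finsetSum fun i _ =>
    (ContinuousLinearMap.contMDiff _).contMDiffAt.comp x₀ (h (b i))

/-- A section of a bundle of homomorphisms is smooth if it maps smooth sections to smooth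
sections. -/
lemma contMDiffAt_hom_of_apply [FiniteDimensional ℝ F₁] [ContMDiffVectorBundle n F₁ E₁ IB]
    {ϕ : ∀ x, E₁ x →L[ℝ] E₂ x}
    (h : ∀ σ : ∀ x, E₁ x, ContMDiffAt IB (IB.prod 𝓘(ℝ, F₁)) n
      (fun x => TotalSpace.mk' F₁ x (σ x)) x₀ →
      ContMDiffAt IB (IB.prod 𝓘(ℝ, F₂)) n (fun x => TotalSpace.mk' F₂ x (ϕ x (σ x))) x₀) :
    ContMDiffAt IB (IB.prod 𝓘(ℝ, F₁ →L[ℝ] F₂)) n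
      (fun x => TotalSpace.mk' (F₁ →L[ℝ] F₂) (E := fun x => E₁ x →L[ℝ] E₂ x) x (ϕ x)) x₀ := by
  rw [contMDiffAt_hom_bundle]
  refine ⟨contMDiffAt_id, contMDiffAt_clm_of_apply fun v => ?_⟩
  -- The test section is the one that is constantly `v` in the trivialization at `x₀`; its image
  -- reads off the evaluation at `v` of the coordinate expression of `ϕ`.
  have h1 := ((trivializationAt F₁ E₁ x₀).contMDiffAt_symmL (n := n) (IB := IB)
    (mem_baseSet_trivializationAt F₁ E₁ x₀)).clm_bundle_apply
      (E₁ := Bundle.Trivial B F₁) (v := fun _ => v) (by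
        rw [Bundle.contMDiffAt_section]; exact contMDiffAt_const)
  have h2 := (contMDiffAt_totalSpace.1 (h _ h1)).2
  refine h2.congr_of_eventuallyEq ?_
  filter_upwards [(trivializationAt F₂ E₂ x₀).open_baseSet.mem_nhds
    (mem_baseSet_trivializationAt F₂ E₂ x₀)] with x hx
  simp [ContinuousLinearMap.inCoordinates, Trivialization.coe_linearMapAt_of_mem _ hx]

/-- The inverse of a smooth isomorphism of vector bundles is smooth. -/
lemma contMDiffAt_hom_inverse [CompleteSpace F₁] {ϕ : ∀ x, E₁ x →L[ℝ] E₂ x}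
    {ψ : ∀ x, E₂ x →L[ℝ] E₁ x} (h₁ : ∀ x v, ψ x (ϕ x v) = v) (h₂ : ∀ x v, ϕ x (ψ x v) = v)
    (hϕ : ContMDiffAt IB (IB.prod 𝓘(ℝ, F₁ →L[ℝ] F₂)) n
      (fun x => TotalSpace.mk' (F₁ →L[ℝ] F₂) (E := fun x => E₁ x →L[ℝ] E₂ x) x (ϕ x)) x₀) :
    ContMDiffAt IB (IB.prod 𝓘(ℝ, F₂ →L[ℝ] F₁)) n
      (fun x => TotalSpace.mk' (F₂ →L[ℝ] F₁) (E := fun x => E₂ x →L[ℝ] E₁ x) x (ψ x)) x₀ := by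
  rw [contMDiffAt_hom_bundle] at hϕ ⊢
  refine ⟨contMDiffAt_id, ?_⟩
  have h₃ : ∀ x ∈ (trivializationAt F₁ E₁ x₀).baseSet, ∀ v,
      (trivializationAt F₁ E₁ x₀).symmL ℝ x
        ((trivializationAt F₁ E₁ x₀).continuousLinearMapAt ℝ x v) = v := fun x hx v =>
    Trivialization.symmL_continuousLinearMapAt _ hx v
  have h₄ : ∀ x ∈ (trivializationAt F₁ E₁ x₀).baseSet, ∀ v,
      (trivializationAt F₁ E₁ x₀).continuousLinearMapAt ℝ x
        ((trivializationAt F₁ E₁ x₀).symmL ℝ x v) = v := fun x hx v =>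
    Trivialization.continuousLinearMapAt_symmL _ hx v
  have h₅ : ∀ x ∈ (trivializationAt F₂ E₂ x₀).baseSet, ∀ v,
      (trivializationAt F₂ E₂ x₀).symmL ℝ x
        ((trivializationAt F₂ E₂ x₀).continuousLinearMapAt ℝ x v) = v := fun x hx v =>
    Trivialization.symmL_continuousLinearMapAt _ hx v
  have h₆ : ∀ x ∈ (trivializationAt F₂ E₂ x₀).baseSet, ∀ v,
      (trivializationAt F₂ E₂ x₀).continuousLinearMapAt ℝ x
        ((trivializationAt F₂ E₂ x₀).symmL ℝ x v) = v := fun x hx v =>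
    Trivialization.continuousLinearMapAt_symmL _ hx v
  have hfg : ∀ x ∈ (trivializationAt F₁ E₁ x₀).baseSet, x ∈ (trivializationAt F₂ E₂ x₀).baseSet →
      (ContinuousLinearMap.inCoordinates F₁ E₁ F₂ E₂ x₀ x x₀ x (ϕ x)).comp
        (ContinuousLinearMap.inCoordinates F₂ E₂ F₁ E₁ x₀ x x₀ x (ψ x)) = .id ℝ F₂ ∧
      (ContinuousLinearMap.inCoordinates F₂ E₂ F₁ E₁ x₀ x x₀ x (ψ x)).comp
        (ContinuousLinearMap.inCoordinates F₁ E₁ F₂ E₂ x₀ x x₀ x (ϕ x)) = .id ℝ F₁ :=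
    fun x hx hx' => by
      constructor <;> ext v <;>
        simp only [ContinuousLinearMap.inCoordinates, ContinuousLinearMap.comp_apply, h₃ x hx,
          h₅ x hx', h₁, h₂, h₄ x hx, h₆ x hx', ContinuousLinearMap.id_apply]
  have hx₁ := mem_baseSet_trivializationAt F₁ E₁ x₀
  have hx₂ := mem_baseSet_trivializationAt F₂ E₂ x₀
  have hinv : (ContinuousLinearMap.inCoordinates F₁ E₁ F₂ E₂ x₀ x₀ x₀ x₀ (ϕ x₀)).IsInvertible :=
    .of_inverse (hfg x₀ hx₁ hx₂).1 (hfg x₀ hx₁ hx₂).2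
  -- Inversion of continuous linear maps is smooth at an invertible one, and near `x₀` the
  -- coordinate expression of `ψ` is the inverse of that of `ϕ`.
  refine (hinv.contDiffAt_map_inverse.contMDiffAt.comp x₀ hϕ.2).congr_of_eventuallyEq ?_
  filter_upwards [(trivializationAt F₁ E₁ x₀).open_baseSet.mem_nhds hx₁,
    (trivializationAt F₂ E₂ x₀).open_baseSet.mem_nhds hx₂] with x hx hx'
  exact (ContinuousLinearMap.inverse_eq (hfg x hx hx').1 (hfg x hx hx').2).symm

end HomBundle

/-! ### Smooth tensor fields tested on smooth vector fields -/

section Tangent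

variable {m : ℕ} {M : Type*} [TopologicalSpace M] [ChartedSpace (Model m) M]
  [IsManifold (𝓡 m) ∞ M]

/-- Smoothness at a point of a vector field. -/
abbrev SmoothVecAt (X : ∀ x : M, TangentSpace (𝓡 m) x) (x₀ : M) : Prop :=
  ContMDiffAt (𝓡 m) ((𝓡 m).prod 𝓘(ℝ, Model m)) ∞ (fun x => TotalSpace.mk' (Model m) x (X x)) x₀

/-- Smoothness at a point of a 1-form. -/
abbrev SmoothFormAt (η : ∀ x : M, TangentSpace (𝓡 m) x →L[ℝ] ℝ) (x₀ : M) : Prop :=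
  ContMDiffAt (𝓡 m) ((𝓡 m).prod 𝓘(ℝ, Model m →L[ℝ] ℝ)) ∞
    (fun x => TotalSpace.mk' (Model m →L[ℝ] ℝ) (E := fun x : M => TangentSpace (𝓡 m) x →L[ℝ] ℝ)
      x (η x)) x₀

/-- Smoothness at a point of a field of endomorphisms. -/
abbrev SmoothEndoAt (A : ∀ x : M, TangentSpace (𝓡 m) x →L[ℝ] TangentSpace (𝓡 m) x) (x₀ : M) :
    Prop :=
  ContMDiffAt (𝓡 m) ((𝓡 m).prod 𝓘(ℝ, Model m →L[ℝ] Model m)) ∞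
    (fun x => TotalSpace.mk' (Model m →L[ℝ] Model m)
      (E := fun x : M => TangentSpace (𝓡 m) x →L[ℝ] TangentSpace (𝓡 m) x) x (A x)) x₀

/-- Smoothness at a point of a field of bilinear forms. -/
abbrev SmoothBilinAt (b : ∀ x : M, TangentSpace (𝓡 m) x →L[ℝ] TangentSpace (𝓡 m) x →L[ℝ] ℝ)
    (x₀ : M) : Prop :=
  ContMDiffAt (𝓡 m) ((𝓡 m).prod 𝓘(ℝ, Model m →L[ℝ] Model m →L[ℝ] ℝ)) ∞
    (fun x => TotalSpace.mk' (Model m →L[ℝ] Model m →L[ℝ] ℝ)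
      (E := fun x : M => TangentSpace (𝓡 m) x →L[ℝ] TangentSpace (𝓡 m) x →L[ℝ] ℝ) x (b x)) x₀

variable {x₀ : M}

lemma smoothFormAt_iff {η : ∀ x : M, TangentSpace (𝓡 m) x →L[ℝ] ℝ} :
    SmoothFormAt η x₀ ↔ ∀ X : ∀ x : M, TangentSpace (𝓡 m) x, SmoothVecAt X x₀ →
      ContMDiffAt (𝓡 m) 𝓘(ℝ) ∞ (fun x => η x (X x)) x₀ := by
  refine ⟨fun h X hX => ?_, fun h => ?_⟩
  · have := h.clm_bundle_apply hX
    rwa [Bundle.contMDiffAt_section] at this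
  · refine contMDiffAt_hom_of_apply (E₂ := Bundle.Trivial M ℝ) fun X hX => ?_
    rw [Bundle.contMDiffAt_section]
    exact h X hX

lemma smoothEndoAt_iff {A : ∀ x : M, TangentSpace (𝓡 m) x →L[ℝ] TangentSpace (𝓡 m) x} :
    SmoothEndoAt A x₀ ↔ ∀ X : ∀ x : M, TangentSpace (𝓡 m) x, SmoothVecAt X x₀ →
      SmoothVecAt (fun x => A x (X x)) x₀ :=
  ⟨fun h _ hX => h.clm_bundle_apply hX, fun h => contMDiffAt_hom_of_apply h⟩

lemma smoothBilinAt_iff {b : ∀ x : M, TangentSpace (𝓡 m) x →L[ℝ] TangentSpace (𝓡 m) x →L[ℝ] ℝ} :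
    SmoothBilinAt b x₀ ↔ ∀ X : ∀ x : M, TangentSpace (𝓡 m) x, SmoothVecAt X x₀ →
      SmoothFormAt (fun x => b x (X x)) x₀ :=
  ⟨fun h _ hX => h.clm_bundle_apply hX,
    fun h => contMDiffAt_hom_of_apply (E₂ := fun x : M => TangentSpace (𝓡 m) x →L[ℝ] ℝ) h⟩

lemma smoothBilinAt_iff₂ {b : ∀ x : M, TangentSpace (𝓡 m) x →L[ℝ] TangentSpace (𝓡 m) x →L[ℝ] ℝ} :
    SmoothBilinAt b x₀ ↔ ∀ X Y : ∀ x : M, TangentSpace (𝓡 m) x, SmoothVecAt X x₀ →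
      SmoothVecAt Y x₀ → ContMDiffAt (𝓡 m) 𝓘(ℝ) ∞ (fun x => b x (X x) (Y x)) x₀ := by
  simp only [smoothBilinAt_iff, smoothFormAt_iff]
  exact ⟨fun h X Y hX hY => h X hX Y hY, fun h X hX Y hY => h X Y hX hY⟩

/-- The differential of a smooth function is a smooth 1-form. -/
lemma smoothFormAt_mvfderiv {f : M → ℝ} (hf : ContMDiffAt (𝓡 m) 𝓘(ℝ) ∞ f x₀) :
    SmoothFormAt (fun x => mvfderiv (𝓡 m) f x) x₀ := by
  have h := hf.mfderiv_const (m := ∞) (by simp)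
  rw [SmoothFormAt, contMDiffAt_hom_bundle]
  refine ⟨contMDiffAt_id, h.congr_of_eventuallyEq (Filter.Eventually.of_forall fun x => ?_)⟩
  ext v
  simp [inTangentCoordinates, ContinuousLinearMap.inCoordinates, mvfderiv]
  rfl

end Tangent

end DualConn

end

noncomputable section

namespace DualConn

/-! ### Positive and nondegenerate bilinear forms; local square roots of operators -/

section NormedSpace

variable {E : Type*} [NormedAddCommGroup E] [NormedSpace ℝ E] [FiniteDimensional ℝ E]

/-- By compactness the quadratic form has a positive minimum on the unit sphere, and homogeneity
does the rest. -/
lemma exists_pos_mul_norm_sq_le {b : E →L[ℝ] E →L[ℝ] ℝ} (hb : ∀ v, v ≠ 0 → 0 < b v v) :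
    ∃ c > 0, ∀ v, c * ‖v‖ ^ 2 ≤ b v v := by
  have hcont : Continuous fun v => b v v := by fun_prop
  obtain ⟨c, hc, hmin⟩ : ∃ c > 0, ∀ v ∈ Metric.sphere (0 : E) 1, c ≤ b v v := by
    -- The sphere is empty when the space is zero, and then any constant works.
    rcases (Metric.sphere (0 : E) 1).eq_empty_or_nonempty with he | hne
    · exact ⟨1, one_pos, by simp [he]⟩
    · obtain ⟨u, hu, hmin⟩ := (isCompact_sphere (0 : E) 1).exists_isMinOn hne hcont.continuousOn
      exact ⟨b u u, hb u (ne_zero_of_mem_unit_sphere ⟨u, hu⟩), fun v hv => hmin hv⟩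
  refine ⟨c, hc, fun v => ?_⟩
  rcases eq_or_ne v 0 with rfl | hv
  · simp
  · have hv' : ‖v‖ ≠ 0 := norm_ne_zero_iff.2 hv
    have h := hmin (‖v‖⁻¹ • v) (by simp [norm_smul, hv'])
    simp only [map_smul, smul_apply, smul_eq_mul] at h
    have h' := mul_le_mul_of_nonneg_right h (sq_nonneg ‖v‖)
    convert! h' using 1
    field_simp

-- Positivity is an open condition, even for forms that are not symmetric: a perturbation smaller in
-- norm than the coercivity constant cannot destroy it.
set_option synthInstance.maxHeartbeats 100000 in
lemma eventually_posDef {b : E →L[ℝ] E →L[ℝ] ℝ} (hb : ∀ v, v ≠ 0 → 0 < b v v) :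
    ∀ᶠ b' in nhds b, ∀ v, v ≠ 0 → 0 < b' v v := by
  obtain ⟨c, hc, hcb⟩ := exists_pos_mul_norm_sq_le hb
  filter_upwards [Metric.ball_mem_nhds b hc] with b' hb' v hv
  have h1 : ‖(b' - b) v v‖ ≤ ‖b' - b‖ * ‖v‖ * ‖v‖ := (b' - b).le_opNorm₂ v v
  have hb' : ‖b' - b‖ < c := (mem_ball_iff_norm (E := E →L[ℝ] E →L[ℝ] ℝ)).1 hb'
  have h2 : (0 : ℝ) < ‖v‖ ^ 2 := by have := norm_pos_iff.2 hv; positivity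
  have h3 := hcb v
  have h4 := neg_abs_le ((b' - b) v v)
  rw [Real.norm_eq_abs] at h1
  simp only [sub_apply] at h1 h4
  nlinarith

lemma isVonNBounded_of_posDef {b : E →L[ℝ] E →L[ℝ] ℝ} (hb : ∀ v, v ≠ 0 → 0 < b v v) :
    Bornology.IsVonNBounded ℝ {v : E | b v v < 1} := by
  obtain ⟨c, hc, hcb⟩ := exists_pos_mul_norm_sq_le hb
  rw [NormedSpace.isVonNBounded_iff]
  refine (Metric.isBounded_closedBall (x := (0 : E)) (r := √(1 / c))).subset fun v hv => ?_
  rw [mem_closedBall_zero_iff]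
  refine Real.le_sqrt_of_sq_le ?_
  rw [le_div_iff₀ hc]
  have := hcb v
  have : b v v < 1 := hv
  linarith

lemma isInvertible_of_nondegenerate {b : E →L[ℝ] E →L[ℝ] ℝ}
    (hb : ∀ v, (∀ w, b v w = 0) → v = 0) : b.IsInvertible := by
  have hinj : Function.Injective (b : E →ₗ[ℝ] E →L[ℝ] ℝ) := by
    rw [← LinearMap.ker_eq_bot, LinearMap.ker_eq_bot']
    exact fun v hv => hb v fun w => by
      have := congrArg (fun f => f w) hv
      simpa using this
  have hdim : Module.finrank ℝ E = Module.finrank ℝ (E →L[ℝ] ℝ) := by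
    rw [← (LinearMap.toContinuousLinearMap (E := E) (F' := ℝ) (𝕜 := ℝ)).finrank_eq]
    exact Subspace.dual_finrank_eq.symm
  refine ⟨(LinearEquiv.ofInjectiveOfFinrankEq _ hinj hdim).toContinuousLinearEquiv, ?_⟩
  ext v w
  rfl

/-- The pullback of the inner product of an inner product space. -/
def pullbackInner {F : Type*} [NormedAddCommGroup F] [InnerProductSpace ℝ F] (L : E →L[ℝ] F) :
    E →L[ℝ] E →L[ℝ] ℝ :=
  (innerSL ℝ).bilinearComp L L

/-- The operator `H ↦ S H + H S`. -/
def sylvesterMap (S : E →L[ℝ] E) : (E →L[ℝ] E) →L[ℝ] E →L[ℝ] E :=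
  ContinuousLinearMap.mul ℝ (E →L[ℝ] E) S + (ContinuousLinearMap.mul ℝ (E →L[ℝ] E)).flip S

/-- Squaring has a smooth local inverse where its derivative is injective. -/
lemma exists_local_sqrt {S : E →L[ℝ] E}
    (hS : ∀ H : E →L[ℝ] E, S * H + H * S = 0 → H = 0) :
    ∃ Λ : (E →L[ℝ] E) → E →L[ℝ] E, ContDiffAt ℝ ∞ Λ (S * S) ∧ Λ (S * S) = S ∧
      ∀ᶠ P in nhds (S * S), Λ P * Λ P = P := by
  have hinj : Function.Injective (sylvesterMap S : (E →L[ℝ] E) →ₗ[ℝ] E →L[ℝ] E) := by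
    rw [← LinearMap.ker_eq_bot, LinearMap.ker_eq_bot']
    exact fun H hH => hS H hH
  let L : (E →L[ℝ] E) ≃L[ℝ] (E →L[ℝ] E) :=
    (LinearEquiv.ofInjectiveEndo _ hinj).toContinuousLinearEquiv
  have hf : ContDiffAt ℝ ∞ (fun P : E →L[ℝ] E => P * P) S := contDiffAt_id.mul contDiffAt_id
  -- The derivative of squaring at `S` is `H ↦ S H + H S`, bijective by injectivity and finite
  -- dimension, so the inverse function theorem applies.
  have hf' : HasFDerivAt (fun P : E →L[ℝ] E => P * P) (L : (E →L[ℝ] E) →L[ℝ] E →L[ℝ] E) S := by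
    have h := (hasFDerivAt_id (𝕜 := ℝ) S).mul' (hasFDerivAt_id (𝕜 := ℝ) S)
    refine h.congr_fderiv ?_
    ext H v
    rfl
  refine ⟨hf.localInverse hf' (by simp), hf.to_localInverse hf' (by simp),
    hf.localInverse_apply_image hf' (by simp), ?_⟩
  exact (hf.hasStrictFDerivAt' hf' (by simp)).eventually_right_inverse

end NormedSpace

/-! ### Raising indices and existence of Riemannian metrics -/

section Metric

variable {m : ℕ} {M : Type*} [TopologicalSpace M] [ChartedSpace (Model m) M]
  [IsManifold (𝓡 m) ∞ M]

/-- Fields of nondegenerate bilinear forms raise indices smoothly. -/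
lemma exists_smooth_sharp {b : ∀ x : M, TangentSpace (𝓡 m) x →L[ℝ] TangentSpace (𝓡 m) x →L[ℝ] ℝ}
    (hb : ∀ x, SmoothBilinAt b x) (hnd : ∀ x v, (∀ w, b x v w = 0) → v = 0) :
    ∃ ψ : ∀ x : M, (TangentSpace (𝓡 m) x →L[ℝ] ℝ) →L[ℝ] TangentSpace (𝓡 m) x,
      (∀ x α w, b x (ψ x α) w = α w) ∧
      ∀ x₀ (α : ∀ x : M, TangentSpace (𝓡 m) x →L[ℝ] ℝ), SmoothFormAt α x₀ →
        SmoothVecAt (fun x => ψ x (α x)) x₀ := by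
  have hinv : ∀ x, (b x).IsInvertible := fun x =>
    isInvertible_of_nondegenerate (E := Model m) (b := b x) (hnd x)
  have h₁ : ∀ x α, b x ((b x).inverse α) = α := fun x α => by
    obtain ⟨e, he⟩ := hinv x
    rw [← he, ContinuousLinearMap.inverse_equiv]
    exact e.apply_symm_apply α
  have h₂ : ∀ x v, (b x).inverse (b x v) = v := fun x v => by
    obtain ⟨e, he⟩ := hinv x
    rw [← he, ContinuousLinearMap.inverse_equiv]
    exact e.symm_apply_apply v
  refine ⟨fun x => (b x).inverse, fun x α w => by rw [h₁], fun x₀ α hα => ?_⟩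
  exact (contMDiffAt_hom_inverse (E₂ := fun x : M => TangentSpace (𝓡 m) x →L[ℝ] ℝ) h₂ h₁
    (hb x₀)).clm_bundle_apply hα

/-- A smooth field of scalar products is a Riemannian metric. -/
def metricOfBilin (b : ∀ x : M, TangentSpace (𝓡 m) x →L[ℝ] TangentSpace (𝓡 m) x →L[ℝ] ℝ)
    (hb : ∀ x, SmoothBilinAt b x) (hsymm : ∀ x v w, b x v w = b x w v)
    (hpos : ∀ x v, v ≠ 0 → 0 < b x v v) : Metric m M where
  inner := b
  symm := hsymm
  pos := hpos
  isVonNBounded x := isVonNBounded_of_posDef (E := Model m) (b := b x) (hpos x)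
  contMDiff x := hb x

lemma smoothVecAt_symmL {x₀ : M} {f : M → Model m} (hf : ContMDiffAt (𝓡 m) 𝓘(ℝ, Model m) ∞ f x₀) :
    SmoothVecAt (fun x => (trivializationAt (Model m) (TangentSpace (𝓡 m)) x₀).symmL ℝ x (f x))
      x₀ :=
  ((trivializationAt (Model m) (TangentSpace (𝓡 m)) x₀).contMDiffAt_symmL (n := ∞) (IB := 𝓡 m)
    (mem_baseSet_trivializationAt _ _ x₀)).clm_bundle_apply
      (E₁ := Bundle.Trivial M (Model m)) (v := f) (by rw [Bundle.contMDiffAt_section]; exact hf)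

-- Scalar products form a convex set in each fibre, and pulling back the Euclidean product through a
-- trivialization solves the problem locally; a partition of unity globalizes it.
variable (m M) in
set_option synthInstance.maxHeartbeats 100000 in
lemma exists_metric [T2Space M] [SigmaCompactSpace M] : Nonempty (Metric m M) := by
  obtain ⟨s, hs⟩ := exists_contMDiffSection_forall_mem_convex_of_local (n := (⊤ : ℕ∞)) (𝓡 m)
    (F_fiber := Model m →L[ℝ] Model m →L[ℝ] ℝ)
    (fun x : M => TangentSpace (𝓡 m) x →L[ℝ] TangentSpace (𝓡 m) x →L[ℝ] ℝ)
    (fun x => {b | (∀ v w, b v w = b w v) ∧ ∀ v, v ≠ 0 → 0 < b v v})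
    (fun x b₁ h₁ b₂ h₂ s t hs ht hst => ⟨fun v w => by
        simp [h₁.1 v w, h₂.1 v w], fun v hv => by
        have h₁' := h₁.2 v hv
        have h₂' := h₂.2 v hv
        -- The weight `s` may vanish, in which case `t = 1`.
        rcases hs.eq_or_lt with rfl | hs
        · rw [zero_add] at hst
          simpa [hst] using h₂'
        · simp only [add_apply, smul_apply, smul_eq_mul]
          positivity⟩)
    (fun x₀ => by
      let e := trivializationAt (Model m) (TangentSpace (𝓡 m)) x₀
      refine ⟨e.baseSet, e.open_baseSet.mem_nhds (mem_baseSet_trivializationAt _ _ x₀),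
        fun x => pullbackInner (E := Model m) (F := Model m) (e.continuousLinearMapAt ℝ x),
        fun x hx => ?_, fun x hx => ⟨fun v w => ?_, fun v hv => ?_⟩⟩
      · refine ContMDiffAt.contMDiffWithinAt (smoothBilinAt_iff₂.2 fun X Y hX hY => ?_)
        have hX' := (e.contMDiffAt_section_iff hx).1 hX
        have hY' := (e.contMDiffAt_section_iff hx).1 hY
        refine (contDiff_inner.contMDiff.contMDiffAt.comp x
          (hX'.prodMk_space hY')).congr_of_eventuallyEq ?_
        filter_upwards [e.open_baseSet.mem_nhds hx] with y hy
        have h : ∀ Z : ∀ x : M, TangentSpace (𝓡 m) x,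
            e.continuousLinearMapAt ℝ y (Z y) = (e ⟨y, Z y⟩).2 := fun Z => by
          simp [Trivialization.coe_linearMapAt_of_mem _ hy]
        exact congrArg₂ (inner ℝ) (h X) (h Y)
      · exact real_inner_comm (e.continuousLinearMapAt ℝ x w : Model m)
          (e.continuousLinearMapAt ℝ x v)
      · refine real_inner_self_pos.2 (show
          (e.continuousLinearMapAt ℝ x v : Model m) ≠ 0 from fun h =>
          hv ?_)
        have := Trivialization.symmL_continuousLinearMapAt (R := ℝ) e hx v
        rw [h, map_zero] at this
        exact this.symm)
  exact ⟨metricOfBilin s (fun x => s.contMDiff x) (fun x => (hs x).1) (fun x => (hs x).2)⟩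

end Metric

end DualConn

end

noncomputable section

namespace DualConn

/-! ### Smooth dependence of the positive square root -/

section SmoothSqrt

/-- The pullback of a bilinear form along a pair of linear maps. -/
def pullbackBilin {E : Type*} [NormedAddCommGroup E] [NormedSpace ℝ E] (b : E →L[ℝ] E →L[ℝ] ℝ)
    (L L' : E →L[ℝ] E) : E →L[ℝ] E →L[ℝ] ℝ :=
  b.bilinearComp L L'

variable {m : ℕ} {M : Type*} [TopologicalSpace M] [ChartedSpace (Model m) M]
  [IsManifold (𝓡 m) ∞ M]

/-- The positive square root of a smooth field of positive symmetric operators is smooth. -/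
lemma smoothEndoAt_sqrt
    {g : ∀ x : M, TangentSpace (𝓡 m) x →L[ℝ] TangentSpace (𝓡 m) x →L[ℝ] ℝ}
    {Q S : ∀ x : M, TangentSpace (𝓡 m) x →L[ℝ] TangentSpace (𝓡 m) x} {x₀ : M}
    (hg : SmoothBilinAt g x₀) (hsymm : ∀ x v w, g x v w = g x w v)
    (hpos : ∀ x v, v ≠ 0 → 0 < g x v v) (hQ : SmoothEndoAt Q x₀)
    (hS : ∀ x v w, g x (S x v) w = g x v (S x w)) (hS' : ∀ x v, v ≠ 0 → 0 < g x (S x v) v)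
    (hSQ : ∀ x v, S x (S x v) = Q x v) : SmoothEndoAt S x₀ := by
  let e := trivializationAt (Model m) (TangentSpace (𝓡 m) : M → Type _) x₀
  have hx₀ : x₀ ∈ e.baseSet := mem_baseSet_trivializationAt _ _ x₀
  have hic : ∀ x ∈ e.baseSet, ∀ v, e.symmL ℝ x (e.continuousLinearMapAt ℝ x v) = v :=
    fun x hx v => Trivialization.symmL_continuousLinearMapAt _ hx v
  have hci : ∀ x ∈ e.baseSet, ∀ v, e.continuousLinearMapAt ℝ x (e.symmL ℝ x v) = v :=
    fun x hx v => Trivialization.continuousLinearMapAt_symmL _ hx v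
  have hi0 : ∀ x ∈ e.baseSet, ∀ v, v ≠ 0 → e.symmL ℝ x v ≠ 0 := fun x hx v hv h => hv <| by
    rw [← hci x hx v, h, map_zero]
  have hc0 : ∀ x ∈ e.baseSet, ∀ v, v ≠ 0 → e.continuousLinearMapAt ℝ x v ≠ 0 :=
    fun x hx v hv h => hv <| by rw [← hic x hx v, h, map_zero]
  let q : M → Model m →L[ℝ] Model m := fun x =>
    (e.continuousLinearMapAt ℝ x).comp ((Q x).comp (e.symmL ℝ x))
  let s : M → Model m →L[ℝ] Model m := fun x =>
    (e.continuousLinearMapAt ℝ x).comp ((S x).comp (e.symmL ℝ x))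
  have hq : ContMDiffAt (𝓡 m) 𝓘(ℝ, Model m →L[ℝ] Model m) ∞ q x₀ := by
    rw [SmoothEndoAt, contMDiffAt_hom_bundle] at hQ
    exact hQ.2
  have hss : ∀ x ∈ e.baseSet, s x * s x = q x := fun x hx => by
    ext1 v
    change e.continuousLinearMapAt ℝ x (S x (e.symmL ℝ x (e.continuousLinearMapAt ℝ x
      (S x (e.symmL ℝ x v))))) = e.continuousLinearMapAt ℝ x (Q x (e.symmL ℝ x v))
    rw [hic x hx, hSQ]
  suffices hs : ContMDiffAt (𝓡 m) 𝓘(ℝ, Model m →L[ℝ] Model m) ∞ s x₀ by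
    rw [SmoothEndoAt, contMDiffAt_hom_bundle]
    exact ⟨contMDiffAt_id, hs⟩
  have hsylv : ∀ x (T D : TangentSpace (𝓡 m) x →L[ℝ] TangentSpace (𝓡 m) x),
      (∀ v, v ≠ 0 → 0 < g x (T v) v) → (∀ v, S x (D v) + D (T v) = 0) → ∀ v, D v = 0 :=
    fun x T D hT hD v => by
      have : FiniteDimensional ℝ (TangentSpace (𝓡 m) x) :=
        inferInstanceAs (FiniteDimensional ℝ (Model m))
      let gl : TangentSpace (𝓡 m) x →ₗ[ℝ] TangentSpace (𝓡 m) x →ₗ[ℝ] ℝ :=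
        (ContinuousLinearMap.coeLM ℝ).comp (g x).toLinearMap
      exact congrArg (fun f => f v) (eq_zero_of_sylvester (g := gl) (S := (S x).toLinearMap)
        (T := T.toLinearMap) (D := D.toLinearMap) (hsymm x) (hpos x) (hS x) (hS' x) hT hD)
  -- `Λ ∘ q` is a smooth square root of `q` near `x₀` that agrees with `s` at `x₀`. It remains to
  -- identify it with `s` on a neighbourhood.
  obtain ⟨Λ, hΛ, hΛ₀, hΛsq⟩ := exists_local_sqrt (S := s x₀) fun H hH => by
    have h := hsylv x₀ (S x₀)
      ((e.symmL ℝ x₀).comp (H.comp (e.continuousLinearMapAt ℝ x₀))) (hS' x₀) fun v => by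
        have h1 := congrArg (fun f => e.symmL ℝ x₀ (f (e.continuousLinearMapAt ℝ x₀ v))) hH
        change e.symmL ℝ x₀ (e.continuousLinearMapAt ℝ x₀ (S x₀ (e.symmL ℝ x₀ (H _))) +
          H (e.continuousLinearMapAt ℝ x₀ (S x₀ (e.symmL ℝ x₀ _)))) = e.symmL ℝ x₀ 0 at h1
        rw [map_add, map_zero, hic x₀ hx₀, hic x₀ hx₀] at h1
        exact h1
    ext1 v
    have h1 := h (e.symmL ℝ x₀ v)
    change e.symmL ℝ x₀ (H (e.continuousLinearMapAt ℝ x₀ (e.symmL ℝ x₀ v))) = 0 at h1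
    rw [hci x₀ hx₀] at h1
    by_contra hne
    exact hi0 x₀ hx₀ _ hne h1
  rw [hss x₀ hx₀] at hΛ hΛ₀ hΛsq
  have hT : ContMDiffAt (𝓡 m) 𝓘(ℝ, Model m →L[ℝ] Model m) ∞ (fun x => Λ (q x)) x₀ :=
    hΛ.contMDiffAt.comp x₀ hq
  refine hT.congr_of_eventuallyEq ?_
  -- The form `β x` expresses in coordinates the form `g (T ·, ·)` for the candidate root `T`. It is
  -- positive at `x₀`, hence nearby by continuity.
  let β : M → Model m →L[ℝ] Model m →L[ℝ] ℝ := fun x =>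
    pullbackBilin (E := Model m) (g x) ((e.symmL ℝ x).comp (Λ (q x))) (e.symmL ℝ x)
  have hβ_apply : ∀ x v w, β x v w = g x (e.symmL ℝ x (Λ (q x) v)) (e.symmL ℝ x w) :=
    fun _ _ _ => rfl
  have hβ : ContMDiffAt (𝓡 m) 𝓘(ℝ, Model m →L[ℝ] Model m →L[ℝ] ℝ) ∞ β x₀ := by
    refine contMDiffAt_clm_of_apply fun v => contMDiffAt_clm_of_apply fun w => ?_
    simp only [hβ_apply]
    exact smoothBilinAt_iff₂.1 hg _ _
      (smoothVecAt_symmL (hT.clm_apply (contMDiffAt_const (c := v))))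
      (smoothVecAt_symmL (contMDiffAt_const (c := w)))
  have hβpos : ∀ v, v ≠ 0 → 0 < β x₀ v v := fun v hv => by
    rw [hβ_apply, hΛ₀]
    change 0 < g x₀ (e.symmL ℝ x₀ (e.continuousLinearMapAt ℝ x₀ (S x₀ (e.symmL ℝ x₀ v)))) _
    rw [hic x₀ hx₀]
    exact hS' x₀ _ (hi0 x₀ hx₀ v hv)
  filter_upwards [hq.continuousAt.eventually hΛsq,
    hβ.continuousAt.eventually (eventually_posDef hβpos), e.open_baseSet.mem_nhds hx₀]
    with x hx1 hx2 hx
  let T : TangentSpace (𝓡 m) x →L[ℝ] TangentSpace (𝓡 m) x :=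
    (e.symmL ℝ x).comp ((Λ (q x)).comp (e.continuousLinearMapAt ℝ x))
  have hT_apply : ∀ v, T v = e.symmL ℝ x (Λ (q x) (e.continuousLinearMapAt ℝ x v)) :=
    fun _ => rfl
  have hTT : ∀ v, T (T v) = Q x v := fun v => by
    have h1 : Λ (q x) (Λ (q x) (e.continuousLinearMapAt ℝ x v)) =
        e.continuousLinearMapAt ℝ x (Q x (e.symmL ℝ x (e.continuousLinearMapAt ℝ x v))) :=
      congrArg (fun f => f (e.continuousLinearMapAt ℝ x v)) hx1
    rw [hT_apply, hT_apply, hci x hx, h1, hic x hx, hic x hx]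
  have hTpos : ∀ v, v ≠ 0 → 0 < g x (T v) v := fun v hv => by
    have h := hx2 _ (hc0 x hx v hv)
    rw [hβ_apply, hic x hx] at h
    exact h
  -- Uniqueness of the positive root: `S (S - T) + (S - T) T = S² - T² = 0`. Only positivity of `T`
  -- is needed, so its symmetry need not be checked.
  have hST := hsylv x T (S x - T) hTpos fun v => by
    change S x (S x v - T v) + (S x (T v) - T (T v)) = 0
    rw [map_sub, hSQ, hTT]
    abel
  ext1 v
  have h := hST (e.symmL ℝ x v)
  change S x _ - T _ = 0 at h
  change e.continuousLinearMapAt ℝ x (S x (e.symmL ℝ x v)) = _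
  rw [sub_eq_zero.1 h, hT_apply, hci x hx, hci x hx]

end SmoothSqrt

end DualConn

end

noncomputable section

namespace DualConn

/-! ### Operations on smooth vector fields -/

section SectionAlgebra

variable {m : ℕ} {M : Type*} [TopologicalSpace M] [ChartedSpace (Model m) M]
  [IsManifold (𝓡 m) ∞ M] {x₀ : M} {X Y : ∀ x : M, TangentSpace (𝓡 m) x} {f : M → ℝ}

lemma SmoothVecAt.add (hX : SmoothVecAt X x₀) (hY : SmoothVecAt Y x₀) :
    SmoothVecAt (fun x => X x + Y x) x₀ :=
  ContMDiffAt.add_section hX hY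

lemma SmoothVecAt.sub (hX : SmoothVecAt X x₀) (hY : SmoothVecAt Y x₀) :
    SmoothVecAt (fun x => X x - Y x) x₀ :=
  ContMDiffAt.sub_section hX hY

lemma SmoothVecAt.smul (hf : ContMDiffAt (𝓡 m) 𝓘(ℝ) ∞ f x₀) (hX : SmoothVecAt X x₀) :
    SmoothVecAt (fun x => f x • X x) x₀ :=
  ContMDiffAt.smul_section hf hX

lemma exists_clm_inverse {E : Type*} [NormedAddCommGroup E] [NormedSpace ℝ E]
    [FiniteDimensional ℝ E] {S : E →L[ℝ] E} (hS : ∀ v, S v = 0 → v = 0) :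
    ∃ R : E →L[ℝ] E, (∀ v, R (S v) = v) ∧ ∀ v, S (R v) = v := by
  have hinj : Function.Injective (S : E →ₗ[ℝ] E) := by
    rw [← LinearMap.ker_eq_bot, LinearMap.ker_eq_bot']
    exact hS
  let L : E ≃L[ℝ] E := (LinearEquiv.ofInjectiveEndo _ hinj).toContinuousLinearEquiv
  exact ⟨L.symm, L.symm_apply_apply, L.apply_symm_apply⟩

end SectionAlgebra

/-! ### From almost cosymplectic to almost contact structures -/

section AlmostContact

/-- The bilinear map underlying a continuous one. -/
def bilinOfCLM {V : Type*} [AddCommGroup V] [Module ℝ V] [TopologicalSpace V]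
    (b : V →L[ℝ] V →L[ℝ] ℝ) : V →ₗ[ℝ] V →ₗ[ℝ] ℝ :=
  (ContinuousLinearMap.coeLM ℝ).comp b.toLinearMap

variable {n : ℕ} {M : Type*} [TopologicalSpace M] [ChartedSpace (Model (2 * n + 1)) M]
  [IsManifold (𝓡 (2 * n + 1)) ∞ M]

lemma finrank_tangentSpace {m : ℕ} {M : Type*} [TopologicalSpace M] [ChartedSpace (Model m) M]
    (x : M) : Module.finrank ℝ (TangentSpace (𝓡 m) x) = m :=
  finrank_euclideanSpace_fin (𝕜 := ℝ)

/-- The smooth Reeb vector field of an almost cosymplectic structure. -/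
lemma exists_reeb {Ω : TwoForm (2 * n + 1) M} {η : OneForm (2 * n + 1) M}
    (h : IsAlmostCosymplectic Ω η) :
    ∃ ξ : ∀ x : M, TangentSpace (𝓡 (2 * n + 1)) x, (∀ x, SmoothVecAt ξ x) ∧
      (∀ x, η x (ξ x) = 1) ∧ ∀ x w, Ω.toField x (ξ x) w = 0 := by
  have hnd : ∀ (x : M) u, (∀ w, Ω.toField x u w = 0) → η x u = 0 → u = 0 := fun x u hu hηu => by
    obtain ⟨v, hv⟩ := h x
    exact eq_zero_of_wedgePowWedge_ne_zero (finrank_tangentSpace x)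
      (Ω := bilinOfCLM (Ω.toField x)) (η := (η x).toLinearMap) (Ω.alt x) hv hu hηu
  -- Since `Ω` is alternating, `b v v = (η v)²`. A vector in the kernel of `b` therefore lies in
  -- `ker η`, then in the kernel of `Ω`, and is zero.
  let b : ∀ x : M, TangentSpace (𝓡 (2 * n + 1)) x →L[ℝ] TangentSpace (𝓡 (2 * n + 1)) x →L[ℝ] ℝ :=
    fun x => Ω.toField x + (η x).smulRight (η x)
  have hb_apply : ∀ x v w, b x v w = Ω.toField x v w + η x v * η x w := fun _ _ _ => rfl
  have hb : ∀ x, SmoothBilinAt b x := fun x => smoothBilinAt_iff₂.2 fun X Y hX hY => by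
    simp only [hb_apply]
    exact (smoothBilinAt_iff₂.1 (Ω.toField.contMDiff x) X Y hX hY).add
      ((smoothFormAt_iff.1 (η.contMDiff x) X hX).mul (smoothFormAt_iff.1 (η.contMDiff x) Y hY))
  have hbnd : ∀ x v, (∀ w, b x v w = 0) → v = 0 := fun x v hv => by
    have h1 := hv v
    rw [hb_apply, Ω.alt, zero_add] at h1
    have h2 : η x v = 0 := mul_self_eq_zero.1 h1
    refine hnd x v (fun w => ?_) h2
    have h3 := hv w
    rwa [hb_apply, h2, zero_mul, add_zero] at h3
  obtain ⟨ψ, hψ, hψs⟩ := exists_smooth_sharp hb hbnd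
  refine ⟨fun x => ψ x (η x), fun x => hψs x _ (η.contMDiff x), ?_⟩
  have key : ∀ x, η x (ψ x (η x)) = 1 ∧ ∀ w, Ω.toField x (ψ x (η x)) w = 0 := fun x => by
    -- Odd dimension supplies `k ≠ 0` in the kernel of `Ω`. Then `b(k, ·) = η(k) η`, so `k` is `η k`
    -- times the vector dual to `η`; this carries both claims over from `k`.
    obtain ⟨k, hk, hΩk⟩ := exists_ne_zero_forall_eq_zero_of_odd (finrank_tangentSpace x)
      (Ω := bilinOfCLM (Ω.toField x)) (Ω.alt x)
    have hΩk : ∀ w, Ω.toField x k w = 0 := hΩk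
    have hηk : η x k ≠ 0 := fun h0 => hk (hnd x k hΩk h0)
    have hkξ : k - η x k • ψ x (η x) = 0 := hbnd x _ fun w => by
      rw [map_sub, map_smul, sub_apply, smul_apply, hψ, hb_apply, hΩk, zero_add, smul_eq_mul,
        sub_self]
    have hkξ : ψ x (η x) = (η x k)⁻¹ • k := by
      rw [sub_eq_zero.1 hkξ, smul_smul]
      simp only [map_smul, smul_eq_mul]
      have : η x (ψ x (η x)) ≠ 0 := fun h0 => hηk (by
        rw [sub_eq_zero.1 hkξ, map_smul, h0, smul_zero])
      have h2 : η x k = η x k * η x (ψ x (η x)) := by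
        conv_lhs => rw [sub_eq_zero.1 hkξ, map_smul, smul_eq_mul]
      rw [← h2, inv_mul_cancel₀ hηk, one_smul]
    refine ⟨by rw [hkξ, map_smul, smul_eq_mul, inv_mul_cancel₀ hηk], fun w => ?_⟩
    rw [hkξ, map_smul, smul_apply, hΩk, smul_zero]
  exact ⟨fun x => (key x).1, fun x => (key x).2⟩

/-- A Riemannian metric for which `η` is dual to `ξ`. -/
lemma exists_metric_adapted {m : ℕ} {M : Type*} [TopologicalSpace M] [ChartedSpace (Model m) M]
    [IsManifold (𝓡 m) ∞ M] [T2Space M] [SigmaCompactSpace M] {η : OneForm m M}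
    {ξ : ∀ x : M, TangentSpace (𝓡 m) x} (hξ : ∀ x, SmoothVecAt ξ x) (hηξ : ∀ x, η x (ξ x) = 1) :
    ∃ g : Metric m M, ∀ x w, g.inner x (ξ x) w = η x w := by
  obtain ⟨g₀⟩ := exists_metric m M
  -- `P` is the projection onto `ker η` along `ξ`. The new metric is `g₀(P ·, P ·) + η ⊗ η`, which
  -- makes `ξ` a unit normal to `ker η`.
  let P : ∀ x : M, TangentSpace (𝓡 m) x →L[ℝ] TangentSpace (𝓡 m) x := fun x =>
    .id ℝ _ - (η x).smulRight (ξ x)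
  have hP_apply : ∀ x v, P x v = v - η x v • ξ x := fun _ _ => rfl
  have hP : ∀ x, SmoothEndoAt P x := fun x => smoothEndoAt_iff.2 fun X hX =>
    hX.sub ((hξ x).smul (smoothFormAt_iff.1 (η.contMDiff x) X hX))
  let gP : ∀ x : M, TangentSpace (𝓡 m) x →L[ℝ] TangentSpace (𝓡 m) x →L[ℝ] ℝ := fun x =>
    pullbackBilin (E := Model m) (g₀.inner x) (P x) (P x)
  let g : ∀ x : M, TangentSpace (𝓡 m) x →L[ℝ] TangentSpace (𝓡 m) x →L[ℝ] ℝ := fun x =>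
    gP x + (η x).smulRight (η x)
  have hg_apply : ∀ x v w, g x v w = g₀.inner x (P x v) (P x w) + η x v * η x w :=
    fun _ _ _ => rfl
  refine ⟨metricOfBilin g (fun x => smoothBilinAt_iff₂.2 fun X Y hX hY => ?_)
    (fun x v w => ?_) (fun x v hv => ?_), fun x w => ?_⟩
  · simp only [hg_apply]
    exact (smoothBilinAt_iff₂.1 (g₀.contMDiff x) _ _ (smoothEndoAt_iff.1 (hP x) X hX)
      (smoothEndoAt_iff.1 (hP x) Y hY)).add
      ((smoothFormAt_iff.1 (η.contMDiff x) X hX).mul (smoothFormAt_iff.1 (η.contMDiff x) Y hY))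
  · rw [hg_apply, hg_apply, g₀.symm, mul_comm]
  · rw [hg_apply]
    by_cases hPv : P x v = 0
    · have hη : η x v ≠ 0 := fun h0 => hv (by
        rw [hP_apply, h0, zero_smul, sub_zero] at hPv
        exact hPv)
      rw [hPv, map_zero, zero_add]
      exact mul_self_pos.2 hη
    · have := g₀.pos x _ hPv
      have := mul_self_nonneg (η x v)
      positivity
  · change g x (ξ x) w = _
    rw [hg_apply, hP_apply, hηξ, one_smul, sub_self, map_zero, one_mul, zero_apply, zero_add]

/-- A smooth field of positive definite symmetric endomorphisms has a smooth invertible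
symmetric square root. -/
lemma exists_smooth_sqrt {m : ℕ} {M : Type*} [TopologicalSpace M] [ChartedSpace (Model m) M]
    [IsManifold (𝓡 m) ∞ M] (g : Metric m M)
    {Q : ∀ x : M, TangentSpace (𝓡 m) x →L[ℝ] TangentSpace (𝓡 m) x}
    (hQ : ∀ x, SmoothEndoAt Q x)
    (hQsymm : ∀ x v w, g.inner x (Q x v) w = g.inner x v (Q x w))
    (hQpos : ∀ x v, v ≠ 0 → 0 < g.inner x (Q x v) v) :
    ∃ S R : ∀ x : M, TangentSpace (𝓡 m) x →L[ℝ] TangentSpace (𝓡 m) x,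
      (∀ x, SmoothEndoAt R x) ∧ (∀ x v w, g.inner x (S x v) w = g.inner x v (S x w)) ∧
      (∀ x v, v ≠ 0 → 0 < g.inner x (S x v) v) ∧ (∀ x v, S x (S x v) = Q x v) ∧
      (∀ x v, R x (S x v) = v) ∧ ∀ x v, S x (R x v) = v := by
  have hex : ∀ x, ∃ S : TangentSpace (𝓡 m) x →L[ℝ] TangentSpace (𝓡 m) x,
      (∀ v w, g.inner x (S v) w = g.inner x v (S w)) ∧
      (∀ v, v ≠ 0 → 0 < g.inner x (S v) v) ∧ ∀ v, S (S v) = Q x v := fun x => by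
    have : FiniteDimensional ℝ (TangentSpace (𝓡 m) x) :=
      inferInstanceAs (FiniteDimensional ℝ (Model m))
    have : T2Space (TangentSpace (𝓡 m) x) := inferInstanceAs (T2Space (Model m))
    obtain ⟨S, hS⟩ := exists_symmetric_sqrt (g := bilinOfCLM (g.inner x)) (Q := (Q x).toLinearMap)
      (g.symm x) (g.pos x) (hQsymm x) (hQpos x)
    exact ⟨LinearMap.toContinuousLinearMap S, hS⟩
  choose S hSsymm hSpos hSQ using hex
  have hS : ∀ x, SmoothEndoAt S x := fun x =>
    smoothEndoAt_sqrt (g.contMDiff x) g.symm g.pos (hQ x) hSsymm hSpos hSQ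
  have hS0 : ∀ x v, S x v = 0 → v = 0 := fun x v hv => by
    by_contra hne
    have := hSpos x v hne
    rw [hv, map_zero, zero_apply] at this
    exact lt_irrefl _ this
  have hexR : ∀ x, ∃ R : TangentSpace (𝓡 m) x →L[ℝ] TangentSpace (𝓡 m) x,
      (∀ v, R (S x v) = v) ∧ ∀ v, S x (R v) = v := fun x =>
    exists_clm_inverse (E := Model m) (S := S x) (hS0 x)
  choose R hRS hSR using hexR
  exact ⟨S, R, fun x => contMDiffAt_hom_inverse hRS hSR (hS x), hSsymm, hSpos, hSQ, hRS, hSR⟩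

/-- The orthogonal part of the polar decomposition of a skew map `A` whose kernel is spanned
by `ξ` squares to `-Id + η ⊗ ξ`. -/
lemma polar_sq {V : Type*} [AddCommGroup V] [Module ℝ V] [FiniteDimensional ℝ V]
    {g : V →ₗ[ℝ] V →ₗ[ℝ] ℝ} (hsymm : ∀ v w, g v w = g w v) (hpos : ∀ v, v ≠ 0 → 0 < g v v)
    {A S R : V →ₗ[ℝ] V} {η : V →ₗ[ℝ] ℝ} {ξ : V} (hηξ : η ξ = 1) (hAξ : A ξ = 0)
    (hηA : ∀ v, η (A v) = 0) (hS : ∀ v w, g (S v) w = g v (S w))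
    (hSpos : ∀ v, v ≠ 0 → 0 < g (S v) v) (hSQ : ∀ v, S (S v) = η v • ξ - A (A v))
    (hRS : ∀ v, R (S v) = v) (hSR : ∀ v, S (R v) = v) (v : V) :
    A (R (A (R v))) = -v + η v • ξ := by
  have hSA : ∀ v, S (A v) = A (S v) := fun v => by
    -- The commutator `D = S A - A S` satisfies `S D + D S = S² A - A S²`, which is zero because `S²
    -- = η ⊗ ξ - A²` commutes with `A`.
    have hD := eq_zero_of_sylvester hsymm hpos (S := S) (T := S) (D := S ∘ₗ A - A ∘ₗ S)
      hS hSpos hSpos fun v => by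
        simp only [LinearMap.sub_apply, LinearMap.comp_apply, map_sub, hSQ, hηA, map_smul, hAξ,
          smul_zero, zero_smul]
        abel
    exact sub_eq_zero.1 (LinearMap.congr_fun hD v)
  have hRA : ∀ v, R (A v) = A (R v) := fun v => by
    have h1 := hSA (R v)
    rw [hSR] at h1
    rw [← h1, hRS]
  -- This is `v = S² R² v`; applying `η` to it identifies the coefficient of `ξ` with `η v`.
  have hv : v = η (R (R v)) • ξ - A (A (R (R v))) := by rw [← hSQ, hSR, hSR]
  have hηv : η v = η (R (R v)) := by
    have h2 := congrArg η hv
    rwa [map_sub, hηA, map_smul, hηξ, smul_eq_mul, mul_one, sub_zero] at h2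
  rw [hRA, hηv, neg_add_eq_sub, eq_sub_iff_add_eq, add_comm]
  exact eq_sub_iff_add_eq.1 hv

/-- An almost cosymplectic structure induces an almost contact structure. -/
theorem exists_almostContact_of_almostCosymplectic [T2Space M] [SigmaCompactSpace M]
    {Ω : TwoForm (2 * n + 1) M} {η : OneForm (2 * n + 1) M} (h : IsAlmostCosymplectic Ω η) :
    ∃ (φ : EndoField (2 * n + 1) M) (ξ : VectorField (2 * n + 1) M), IsAlmostContact φ ξ η := by
  have hnd : ∀ (x : M) u, (∀ w, Ω.toField x u w = 0) → η x u = 0 → u = 0 := fun x u hu hηu => by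
    obtain ⟨v, hv⟩ := h x
    exact eq_zero_of_wedgePowWedge_ne_zero (finrank_tangentSpace x)
      (Ω := bilinOfCLM (Ω.toField x)) (η := (η x).toLinearMap) (Ω.alt x) hv hu hηu
  have hanti : ∀ x v w, Ω.toField x v w = -Ω.toField x w v := fun x v w => by
    have := Ω.alt x (v + w)
    simp only [map_add, add_apply, Ω.alt, zero_add, add_zero] at this
    linarith
  obtain ⟨ξ, hξ, hηξ, hΩξ⟩ := exists_reeb h
  obtain ⟨g, hgξ⟩ := exists_metric_adapted hξ hηξ
  have hg : ∀ x, SmoothBilinAt g.inner x := fun x => g.contMDiff x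
  have hgnd : ∀ x v, (∀ w, g.inner x v w = 0) → v = 0 := fun x v hv => by
    by_contra hne
    exact (g.pos x v hne).ne' (hv v)
  obtain ⟨ψ, hψ, hψs⟩ := exists_smooth_sharp hg hgnd
  let A : ∀ x : M, TangentSpace (𝓡 (2 * n + 1)) x →L[ℝ] TangentSpace (𝓡 (2 * n + 1)) x :=
    fun x => (ψ x).comp (Ω.toField x)
  have hA_apply : ∀ x v w, g.inner x (A x v) w = Ω.toField x v w := fun x v w => hψ x _ w
  have hA : ∀ x, SmoothEndoAt A x := fun x => smoothEndoAt_iff.2 fun X hX =>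
    hψs x _ (smoothBilinAt_iff.1 (Ω.toField.contMDiff x) X hX)
  have hAskew : ∀ x v w, g.inner x (A x v) w = -g.inner x v (A x w) := fun x v w => by
    rw [hA_apply, hanti, ← hA_apply, g.symm]
  have hAξ : ∀ x, A x (ξ x) = 0 := fun x => hgnd x _ fun w => by rw [hA_apply, hΩξ]
  have hηA : ∀ x v, η x (A x v) = 0 := fun x v => by
    rw [← hgξ, g.symm, hAskew, hAξ, map_zero, neg_zero]
  -- `-A²` is only semidefinite, with kernel spanned by `ξ`; the term `η ⊗ ξ` repairs this, as `g(Q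
  -- v, v) = (η v)² + g(A v, A v)`.
  let Q : ∀ x : M, TangentSpace (𝓡 (2 * n + 1)) x →L[ℝ] TangentSpace (𝓡 (2 * n + 1)) x :=
    fun x => (η x).smulRight (ξ x) - (A x).comp (A x)
  have hQ_apply : ∀ x v, Q x v = η x v • ξ x - A x (A x v) := fun _ _ => rfl
  have hQ : ∀ x, SmoothEndoAt Q x := fun x => smoothEndoAt_iff.2 fun X hX =>
    ((hξ x).smul (smoothFormAt_iff.1 (η.contMDiff x) X hX)).sub
      (smoothEndoAt_iff.1 (hA x) _ (smoothEndoAt_iff.1 (hA x) X hX))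
  have hgQ : ∀ x v w, g.inner x (Q x v) w = η x v * η x w + g.inner x (A x v) (A x w) :=
    fun x v w => by
      rw [hQ_apply, map_sub, map_smul, sub_apply, smul_apply, hgξ, hAskew x (A x v), smul_eq_mul,
        sub_neg_eq_add]
  have hQsymm : ∀ x v w, g.inner x (Q x v) w = g.inner x v (Q x w) := fun x v w => by
    rw [g.symm x v, hgQ, hgQ, mul_comm, g.symm]
  have hQpos : ∀ x v, v ≠ 0 → 0 < g.inner x (Q x v) v := fun x v hv => by
    rw [hgQ]
    by_cases hAv : A x v = 0
    · have hη : η x v ≠ 0 := fun h0 => hv (hnd x v (fun w => by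
        rw [← hA_apply, hAv, map_zero, zero_apply]) h0)
      rw [hAv, map_zero, add_zero]
      exact mul_self_pos.2 hη
    · have := g.pos x _ hAv
      have := mul_self_nonneg (η x v)
      positivity
  obtain ⟨S, R, hR, hSsymm, hSpos, hSQ, hRS, hSR⟩ := exists_smooth_sqrt g hQ hQsymm hQpos
  let φ : EndoField (2 * n + 1) M := ⟨fun x => (A x).comp (R x), fun x =>
    smoothEndoAt_iff.2 fun X hX => smoothEndoAt_iff.1 (hA x) _ (smoothEndoAt_iff.1 (hR x) X hX)⟩
  refine ⟨φ, ⟨ξ, hξ⟩, fun x => ⟨hηξ x, fun v => ?_⟩⟩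
  have : FiniteDimensional ℝ (TangentSpace (𝓡 (2 * n + 1)) x) :=
    inferInstanceAs (FiniteDimensional ℝ (Model (2 * n + 1)))
  exact polar_sq (g := bilinOfCLM (g.inner x)) (A := (A x).toLinearMap)
    (S := (S x).toLinearMap) (R := (R x).toLinearMap) (η := (η x).toLinearMap)
    (g.symm x) (g.pos x) (hηξ x) (hAξ x) (hηA x) (hSsymm x) (hSpos x) (hSQ x) (hRS x) (hSR x) v

end AlmostContact

end DualConn

end

noncomputable section

namespace DualConn

/-! ### Flat connections of local frames and their duals -/

section FrameConnection

variable {m : ℕ} {M : Type*} [TopologicalSpace M] [ChartedSpace (Model m) M]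

/-- The flat connection with parallel frame `E` and dual coframe `α`. -/
def frameConnection (α : Fin m → ∀ x : M, TangentSpace (𝓡 m) x →L[ℝ] ℝ)
    (E : Fin m → ∀ x : M, TangentSpace (𝓡 m) x) (σ : ∀ x : M, TangentSpace (𝓡 m) x) (x : M) :
    TangentSpace (𝓡 m) x →L[ℝ] TangentSpace (𝓡 m) x :=
  ∑ j, (mvfderiv (𝓡 m) (fun y => α j y (σ y)) x).smulRight (E j x)

lemma frameConnection_apply (α : Fin m → ∀ x : M, TangentSpace (𝓡 m) x →L[ℝ] ℝ)
    (E : Fin m → ∀ x : M, TangentSpace (𝓡 m) x) (σ : ∀ x : M, TangentSpace (𝓡 m) x) (x : M)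
    (v : TangentSpace (𝓡 m) x) :
    frameConnection α E σ x v = ∑ j, mvfderiv (𝓡 m) (fun y => α j y (σ y)) x v • E j x := by
  simp [frameConnection, sum_apply]

lemma mvfderiv_finset_sum {ι : Type*} (s : Finset ι) {x₀ : M} {f : ι → M → ℝ}
    (hf : ∀ i, MDifferentiableAt (𝓡 m) 𝓘(ℝ) (f i) x₀) :
    MDifferentiableAt (𝓡 m) 𝓘(ℝ) (∑ i ∈ s, f i) x₀ ∧
      mvfderiv (𝓡 m) (∑ i ∈ s, f i) x₀ = ∑ i ∈ s, mvfderiv (𝓡 m) (f i) x₀ := by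
  classical
  induction s using Finset.induction_on with
  | empty =>
    rw [Finset.sum_empty, Finset.sum_empty]
    exact ⟨mdifferentiableAt_const, mvfderiv_zero⟩
  | insert i s hi ih =>
    rw [Finset.sum_insert hi, Finset.sum_insert hi, mvfderiv_add (hf i) ih.1, ih.2]
    exact ⟨(hf i).add ih.1, rfl⟩

variable [IsManifold (𝓡 m) ∞ M]

/-- Differentiability at a point of a vector field. -/
abbrev DiffVecAt (X : ∀ x : M, TangentSpace (𝓡 m) x) (x₀ : M) : Prop :=
  MDifferentiableAt (𝓡 m) ((𝓡 m).prod 𝓘(ℝ, Model m)) (fun x => TotalSpace.mk' (Model m) x (X x)) x₀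

variable {α : Fin m → ∀ x : M, TangentSpace (𝓡 m) x →L[ℝ] ℝ}
  {E : Fin m → ∀ x : M, TangentSpace (𝓡 m) x}
  {x₀ : M}

lemma SmoothFormAt.mdifferentiableAt_apply {η : ∀ x : M, TangentSpace (𝓡 m) x →L[ℝ] ℝ}
    {X : ∀ x : M, TangentSpace (𝓡 m) x} (hη : SmoothFormAt η x₀) (hX : DiffVecAt X x₀) :
    MDifferentiableAt (𝓡 m) 𝓘(ℝ) (fun x => η x (X x)) x₀ := by
  have := (hη.mdifferentiableAt (by simp)).clm_bundle_apply
    (E₂ := Bundle.Trivial M ℝ) hX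
  exact (mdifferentiableAt_section _ _).1 this

lemma frameConnection_add (hα : ∀ j, SmoothFormAt (α j) x₀) {σ τ : ∀ x : M, TangentSpace (𝓡 m) x}
    (hσ : DiffVecAt σ x₀) (hτ : DiffVecAt τ x₀) :
    frameConnection α E (σ + τ) x₀ = frameConnection α E σ x₀ + frameConnection α E τ x₀ := by
  ext v
  rw [add_apply]
  simp only [frameConnection_apply]
  rw [← Finset.sum_add_distrib]
  refine Finset.sum_congr rfl fun j _ => ?_
  have h : (fun y => α j y ((σ + τ) y)) = (fun y => α j y (σ y)) + fun y => α j y (τ y) := by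
    funext y
    simp
  rw [h, mvfderiv_add ((hα j).mdifferentiableAt_apply hσ) ((hα j).mdifferentiableAt_apply hτ),
    add_apply, add_smul]

lemma frameConnection_smul (hα : ∀ j, SmoothFormAt (α j) x₀)
    (hαE : ∀ v, ∑ j, α j x₀ v • E j x₀ = v) {σ : ∀ x : M, TangentSpace (𝓡 m) x} {f : M → ℝ}
    (hσ : DiffVecAt σ x₀) (hf : MDifferentiableAt (𝓡 m) 𝓘(ℝ) f x₀) :
    frameConnection α E (f • σ) x₀ =
      f x₀ • frameConnection α E σ x₀ + (mvfderiv (𝓡 m) f x₀).smulRight (σ x₀) := by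
  ext v
  rw [add_apply, smul_apply, ContinuousLinearMap.smulRight_apply]
  conv_rhs => rw [← hαE (σ x₀)]
  simp only [frameConnection_apply]
  rw [Finset.smul_sum, Finset.smul_sum, ← Finset.sum_add_distrib]
  refine Finset.sum_congr rfl fun j _ => ?_
  have h : (fun y => α j y ((f • σ) y)) = f * fun y => α j y (σ y) := by
    funext y
    simp
  rw [h, mvfderiv_mul hf ((hα j).mdifferentiableAt_apply hσ), add_apply, smul_apply, smul_apply,
    add_smul, smul_smul, smul_smul]
  simp only [smul_eq_mul, mul_comm]

lemma smoothEndoAt_frameConnection (hα : ∀ j, SmoothFormAt (α j) x₀)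
    (hE : ∀ j, SmoothVecAt (E j) x₀) {σ : ∀ x : M, TangentSpace (𝓡 m) x} (hσ : SmoothVecAt σ x₀) :
    SmoothEndoAt (frameConnection α E σ) x₀ :=
  smoothEndoAt_iff.2 fun X hX => by
    simp only [frameConnection_apply]
    exact ContMDiffAt.sum_section fun j _ => SmoothVecAt.smul (smoothFormAt_iff.1
      (smoothFormAt_mvfderiv (smoothFormAt_iff.1 (hα j) σ hσ)) X hX) (hE j)

/-- The connections defined by a frame and by the frame metrically dual to its coframe are dual. -/
lemma mvfderiv_inner_frameConnection {g : Metric m M}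
    {ψ : ∀ x : M, (TangentSpace (𝓡 m) x →L[ℝ] ℝ) →L[ℝ] TangentSpace (𝓡 m) x}
    (hψ : ∀ x β w, g.inner x (ψ x β) w = β w)
    (hα : ∀ j, SmoothFormAt (α j) x₀) (hE : ∀ j, SmoothVecAt (E j) x₀)
    (hαE : ∀ᶠ x in nhds x₀, ∀ v, ∑ j, α j x v • E j x = v)
    {X Y : ∀ x : M, TangentSpace (𝓡 m) x} (hX : SmoothVecAt X x₀) (hY : SmoothVecAt Y x₀)
    (v : TangentSpace (𝓡 m) x₀) :
    mvfderiv (𝓡 m) (fun x => g.inner x (X x) (Y x)) x₀ v =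
      g.inner x₀ (frameConnection α E X x₀ v) (Y x₀) +
      g.inner x₀ (X x₀) (frameConnection (fun j x => g.inner x (E j x))
        (fun j x => ψ x (α j x)) Y x₀ v) := by
  have hd₁ : ∀ j, MDifferentiableAt (𝓡 m) 𝓘(ℝ) (fun x => α j x (X x)) x₀ := fun j =>
    (smoothFormAt_iff.1 (hα j) X hX).mdifferentiableAt (by simp)
  have hd₂ : ∀ j, MDifferentiableAt (𝓡 m) 𝓘(ℝ) (fun x => g.inner x (E j x) (Y x)) x₀ := fun j =>
    (smoothBilinAt_iff₂.1 (g.contMDiff x₀) _ _ (hE j) hY).mdifferentiableAt (by simp)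
  -- Expanding `X` in the frame gives `g(X, Y) = ∑ α j (X) g(E j, Y)`. The product rule splits its
  -- derivative into the two connection terms, since `g(X, ψ (α j)) = α j (X)`.
  have hsum : (fun x => g.inner x (X x) (Y x)) =ᶠ[nhds x₀]
      ∑ j, (fun x => α j x (X x)) * fun x => g.inner x (E j x) (Y x) := by
    filter_upwards [hαE] with x hx
    conv_lhs => rw [← hx (X x)]
    simp [sum_apply]
  have hcongr : mvfderiv (𝓡 m) (fun x => g.inner x (X x) (Y x)) x₀ = mvfderiv (𝓡 m)
      (∑ j, (fun x => α j x (X x)) * fun x => g.inner x (E j x) (Y x)) x₀ := by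
    rw [mvfderiv, mvfderiv, hsum.mfderiv_eq, hsum.eq_of_nhds]
  rw [hcongr, (mvfderiv_finset_sum _ fun j => (hd₁ j).mul (hd₂ j)).2, frameConnection_apply,
    frameConnection_apply]
  simp only [map_sum, map_smul, sum_apply, smul_apply, smul_eq_mul]
  rw [← Finset.sum_add_distrib]
  refine Finset.sum_congr rfl fun j _ => ?_
  rw [mvfderiv_mul (hd₁ j) (hd₂ j), g.symm x₀ (X x₀), hψ]
  simp only [add_apply, smul_apply, smul_eq_mul]
  ring

end FrameConnection

/-! ### Gluing dual connections by a partition of unity -/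

section Gluing

variable {m : ℕ} {M : Type*} [TopologicalSpace M] [ChartedSpace (Model m) M]

lemma exists_frame (m : ℕ) {M : Type*} [TopologicalSpace M] [ChartedSpace (Model m) M]
    [IsManifold (𝓡 m) ∞ M] (i : M) :
    ∃ (α : Fin m → ∀ x : M, TangentSpace (𝓡 m) x →L[ℝ] ℝ)
      (E : Fin m → ∀ x : M, TangentSpace (𝓡 m) x), ∃ U : Set M, IsOpen U ∧ i ∈ U ∧
      (∀ x ∈ U, ∀ j, SmoothFormAt (α j) x) ∧ (∀ x ∈ U, ∀ j, SmoothVecAt (E j) x) ∧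
      ∀ x ∈ U, ∀ v, ∑ j, α j x v • E j x = v := by
  let e := trivializationAt (Model m) (TangentSpace (𝓡 m) : M → Type _) i
  let b := EuclideanSpace.basisFun (Fin m) ℝ
  let β : Fin m → Model m →L[ℝ] ℝ := fun j => EuclideanSpace.proj j
  refine ⟨fun j x => (β j).comp (e.continuousLinearMapAt ℝ x), fun j x => e.symmL ℝ x (b j),
    e.baseSet, e.open_baseSet, mem_baseSet_trivializationAt _ _ i, fun x hx j => ?_,
    fun x hx j => ?_, fun x hx v => ?_⟩
  · refine smoothFormAt_iff.2 fun X hX => ?_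
    have hX' := (e.contMDiffAt_section_iff hx).1 hX
    refine ((β j).contMDiff.contMDiffAt.comp x hX').congr_of_eventuallyEq ?_
    filter_upwards [e.open_baseSet.mem_nhds hx] with y hy
    simp [Trivialization.coe_linearMapAt_of_mem _ hy]
  · exact (e.contMDiffAt_symmL (n := ∞) (IB := 𝓡 m) hx).clm_bundle_apply
      (E₁ := Bundle.Trivial M (Model m)) (v := fun _ => b j)
      (by rw [Bundle.contMDiffAt_section]; exact contMDiffAt_const)
  · have h1 := b.sum_repr (e.continuousLinearMapAt ℝ x v)
    have h2 := congrArg (e.symmL ℝ x) h1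
    rw [Trivialization.symmL_continuousLinearMapAt _ hx, map_sum] at h2
    refine Eq.trans (Finset.sum_congr rfl fun j _ => ?_) h2
    rw [map_smul]
    rfl

/-- The combination of locally defined connections by means of a partition of unity. -/
def glueConnection (ρ : SmoothPartitionOfUnity M (𝓡 m) M Set.univ)
    (D : M → (∀ x : M, TangentSpace (𝓡 m) x) →
      ∀ x : M, TangentSpace (𝓡 m) x →L[ℝ] TangentSpace (𝓡 m) x)
    (σ : ∀ x : M, TangentSpace (𝓡 m) x) (x : M) :
    TangentSpace (𝓡 m) x →L[ℝ] TangentSpace (𝓡 m) x :=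
  ∑ᶠ i, ρ i x • D i σ x

variable (ρ : SmoothPartitionOfUnity M (𝓡 m) M Set.univ)
    {D : M → (∀ x : M, TangentSpace (𝓡 m) x) →
      ∀ x : M, TangentSpace (𝓡 m) x →L[ℝ] TangentSpace (𝓡 m) x} {U : M → Set M}

lemma glueConnection_eq (σ : ∀ x : M, TangentSpace (𝓡 m) x) (x : M) :
    glueConnection ρ D σ x = ∑ i ∈ ρ.finsupport x, ρ i x • D i σ x := by
  rw [glueConnection]
  refine finsum_eq_sum_of_support_subset _ fun i hi => ?_
  rw [ρ.coe_finsupport]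
  exact left_ne_zero_of_smul hi

variable {ρ}

lemma mem_of_mem_finsupport (hρ : ρ.IsSubordinate U) {x i : M} (hi : i ∈ ρ.finsupport x) :
    x ∈ U i :=
  hρ i (subset_closure ((ρ.mem_finsupport x).1 hi))

variable [IsManifold (𝓡 m) ∞ M]

/-- Connections form an affine space: the Leibniz terms add up correctly because the weights at each
point sum to one. -/
lemma isCovariantDerivativeOn_glueConnection (hρ : ρ.IsSubordinate U)
    (hD : ∀ i, IsCovariantDerivativeOn (Model m) (D i) (U i)) :
    IsCovariantDerivativeOn (Model m) (glueConnection ρ D) Set.univ where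
  add {σ τ x} hσ hτ _ := by
    simp only [glueConnection_eq]
    rw [← Finset.sum_add_distrib]
    refine Finset.sum_congr rfl fun i hi => ?_
    rw [(hD i).add hσ hτ (mem_of_mem_finsupport hρ hi), smul_add]
  leibniz {σ f x} hσ hf _ := by
    have h1 : (mvfderiv (𝓡 m) f x).smulRight (σ x) =
        ∑ i ∈ ρ.finsupport x, ρ i x • (mvfderiv (𝓡 m) f x).smulRight (σ x) := by
      rw [← Finset.sum_smul, ρ.sum_finsupport x (Set.mem_univ x), one_smul]
    rw [h1]
    simp only [glueConnection_eq]
    rw [Finset.smul_sum, ← Finset.sum_add_distrib]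
    refine Finset.sum_congr rfl fun i hi => ?_
    rw [(hD i).leibniz hσ hf (mem_of_mem_finsupport hρ hi), smul_add, smul_comm]

lemma smoothEndoAt_glueConnection (hρ : ρ.IsSubordinate U) (hU : ∀ i, IsOpen (U i))
    {σ : ∀ x : M, TangentSpace (𝓡 m) x} (hD : ∀ i, ∀ x ∈ U i, SmoothEndoAt (D i σ) x) (x : M) :
    SmoothEndoAt (glueConnection ρ D σ) x := by
  refine ContMDiff.finsum_section_of_locallyFinite
    (V := fun x : M => TangentSpace (𝓡 m) x →L[ℝ] TangentSpace (𝓡 m) x)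
    (t := fun i x => ρ i x • D i σ x) (ρ.locallyFinite.subset fun i x hx => ?_) (fun i => ?_) x
  · exact left_ne_zero_of_smul hx
  -- `D i σ` is smooth only on `U i`, but `ρ i` vanishes near every point outside `U i`.
  · exact ContMDiffOn.smul_section_of_tsupport
      (V := fun x : M => TangentSpace (𝓡 m) x →L[ℝ] TangentSpace (𝓡 m) x)
      (ρ i).contMDiff.contMDiffOn (hU i) (hρ i) fun x hx => (hD i x hx).contMDiffWithinAt

/-- Every Riemannian metric has a pair of dual connections. -/
theorem exists_dual_connections [T2Space M] [SigmaCompactSpace M] (g : Metric m M) :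
    ∃ D D' : Connection m M,
      (∀ σ : ∀ x : M, TangentSpace (𝓡 m) x, (∀ x, SmoothVecAt σ x) → ∀ x, SmoothEndoAt (D σ) x) ∧
      (∀ σ : ∀ x : M, TangentSpace (𝓡 m) x, (∀ x, SmoothVecAt σ x) → ∀ x, SmoothEndoAt (D' σ) x) ∧
      ∀ (X Y : ∀ x : M, TangentSpace (𝓡 m) x) (x : M), SmoothVecAt X x → SmoothVecAt Y x → ∀ v,
        mvfderiv (𝓡 m) (fun y => g.inner y (X y) (Y y)) x v =
          g.inner x (D X x v) (Y x) + g.inner x (X x) (D' Y x v) := by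
  have hgnd : ∀ x v, (∀ w, g.inner x v w = 0) → v = 0 := fun x v hv => by
    by_contra hne
    exact (g.pos x v hne).ne' (hv v)
  obtain ⟨ψ, hψ, hψs⟩ := exists_smooth_sharp (fun x => g.contMDiff x) hgnd
  choose α E U hU hiU hα hE hαE using exists_frame m (M := M)
  obtain ⟨ρ, hρ⟩ := SmoothPartitionOfUnity.exists_isSubordinate (𝓡 m) isClosed_univ U hU
    fun x _ => Set.mem_iUnion.2 ⟨x, hiU x⟩
  let α' : M → Fin m → ∀ x : M, TangentSpace (𝓡 m) x →L[ℝ] ℝ := fun i j x => g.inner x (E i j x)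
  let E' : M → Fin m → ∀ x : M, TangentSpace (𝓡 m) x := fun i j x => ψ x (α i j x)
  have hα' : ∀ i, ∀ x ∈ U i, ∀ j, SmoothFormAt (α' i j) x := fun i x hx j =>
    smoothBilinAt_iff.1 (g.contMDiff x) _ (hE i x hx j)
  have hE' : ∀ i, ∀ x ∈ U i, ∀ j, SmoothVecAt (E' i j) x := fun i x hx j =>
    hψs x _ (hα i x hx j)
  have hαE' : ∀ i, ∀ x ∈ U i, ∀ v, ∑ j, α' i j x v • E' i j x = v := fun i x hx v => by
    refine sub_eq_zero.1 (hgnd x _ fun w => ?_)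
    have h1 := congrArg (fun u => g.inner x u v) (hαE i x hx w)
    simp only [map_sum, map_smul, sum_apply, smul_apply, smul_eq_mul] at h1
    rw [map_sub, sub_apply, g.symm x v, ← h1, sub_eq_zero, map_sum, sum_apply]
    refine Finset.sum_congr rfl fun j _ => ?_
    rw [map_smul, smul_apply, hψ, smul_eq_mul, mul_comm]
  have hcov : ∀ i, IsCovariantDerivativeOn (Model m) (frameConnection (α i) (E i)) (U i) :=
    fun i => ⟨fun hσ hτ hx => frameConnection_add (hα i _ hx) hσ hτ,
      fun hσ hf hx => frameConnection_smul (hα i _ hx) (hαE i _ hx) hσ hf⟩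
  have hcov' : ∀ i, IsCovariantDerivativeOn (Model m) (frameConnection (α' i) (E' i)) (U i) :=
    fun i => ⟨fun hσ hτ hx => frameConnection_add (hα' i _ hx) hσ hτ,
      fun hσ hf hx => frameConnection_smul (hα' i _ hx) (hαE' i _ hx) hσ hf⟩
  refine ⟨⟨_, isCovariantDerivativeOn_glueConnection hρ hcov⟩,
    ⟨_, isCovariantDerivativeOn_glueConnection hρ hcov'⟩,
    fun σ hσ => smoothEndoAt_glueConnection hρ hU fun i x hx =>
      smoothEndoAt_frameConnection (hα i x hx) (hE i x hx) (hσ x),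
    fun σ hσ => smoothEndoAt_glueConnection hρ hU fun i x hx =>
      smoothEndoAt_frameConnection (hα' i x hx) (hE' i x hx) (hσ x), fun X Y x hX hY v => ?_⟩
  change _ = g.inner x (glueConnection ρ _ X x v) (Y x) +
    g.inner x (X x) (glueConnection ρ _ Y x v)
  simp only [glueConnection_eq, map_sum, map_smul, sum_apply, smul_apply, smul_eq_mul]
  rw [← Finset.sum_add_distrib]
  -- The duality identity is affine in the pair of connections, so it survives gluing both with the
  -- same weights.
  have h1 : mvfderiv (𝓡 m) (fun y => g.inner y (X y) (Y y)) x v = ∑ i ∈ ρ.finsupport x,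
      ρ i x * mvfderiv (𝓡 m) (fun y => g.inner y (X y) (Y y)) x v := by
    rw [← Finset.sum_mul, ρ.sum_finsupport x (Set.mem_univ x), one_mul]
  rw [h1]
  refine Finset.sum_congr rfl fun i hi => ?_
  have hx := mem_of_mem_finsupport hρ hi
  rw [mvfderiv_inner_frameConnection hψ (hα i x hx) (hE i x hx)
    (Filter.eventually_of_mem ((hU i).mem_nhds hx) (hαE i)) hX hY, mul_add]

end Gluing

end DualConn

end

noncomputable section

namespace DualConn

/-! ### The averaged connection -/

section TwistedConnection

variable {m : ℕ} {M : Type*} [TopologicalSpace M] [ChartedSpace (Model m) M]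
  [IsManifold (𝓡 m) ∞ M]

lemma DiffVecAt.endo {σ : ∀ x : M, TangentSpace (𝓡 m) x} {x₀ : M} (φ : EndoField m M)
    (hσ : DiffVecAt σ x₀) : DiffVecAt (fun x => φ x (σ x)) x₀ :=
  ((φ.contMDiff x₀).mdifferentiableAt (by simp)).clm_bundle_apply
    (E₁ := fun x : M => TangentSpace (𝓡 m) x) (E₂ := fun x : M => TangentSpace (𝓡 m) x) hσ

lemma SmoothVecAt.endo {σ : ∀ x : M, TangentSpace (𝓡 m) x} {x₀ : M} (φ : EndoField m M)
    (hσ : SmoothVecAt σ x₀) : SmoothVecAt (fun x => φ x (σ x)) x₀ :=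
  smoothEndoAt_iff.1 (φ.contMDiff x₀) σ hσ

/-- The operator `σ ↦ (P (D (P σ)) - φ (D' (φ σ))) / 2 + d(η σ) ⊗ ξ`. -/
def twist (P φ : EndoField m M) (ξ : VectorField m M) (η : OneForm m M) (D D' : Connection m M)
    (σ : ∀ x : M, TangentSpace (𝓡 m) x) (x : M) :
    TangentSpace (𝓡 m) x →L[ℝ] TangentSpace (𝓡 m) x :=
  (1 / 2 : ℝ) • ((P x).comp (D (fun y => P y (σ y)) x) - (φ x).comp (D' (fun y => φ y (σ y)) x)) +
    (mvfderiv (𝓡 m) (fun y => η y (σ y)) x).smulRight (ξ x)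

variable {P φ : EndoField m M} {ξ : VectorField m M} {η : OneForm m M} {D D' : Connection m M}

lemma twist_apply (σ : ∀ x : M, TangentSpace (𝓡 m) x) (x : M) (v : TangentSpace (𝓡 m) x) :
    twist P φ ξ η D D' σ x v = (1 / 2 : ℝ) • (P x (D (fun y => P y (σ y)) x v) -
      φ x (D' (fun y => φ y (σ y)) x v)) + mvfderiv (𝓡 m) (fun y => η y (σ y)) x v • ξ x :=
  rfl

/-- The hypothesis says exactly that the three zeroth-order contributions to the Leibniz rule add up
to the identity. -/
lemma isCovariantDerivativeOn_twist
    (h : ∀ x v, (1 / 2 : ℝ) • (P x (P x v) - φ x (φ x v)) + η x v • ξ x = v) :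
    IsCovariantDerivativeOn (Model m) (twist P φ ξ η D D') Set.univ where
  add {σ τ x} hσ hτ _ := by
    have h₁ : ∀ ψ : EndoField m M, (fun y => ψ y ((σ + τ) y)) =
        (fun y => ψ y (σ y)) + fun y => ψ y (τ y) := fun ψ => by
      funext y
      simp
    have h₂ : (fun y => η y ((σ + τ) y)) = (fun y => η y (σ y)) + fun y => η y (τ y) := by
      funext y
      simp
    ext v
    rw [add_apply, twist_apply, twist_apply, twist_apply, h₁, h₁, h₂,
      D.isCovariantDerivativeOnUniv.add (DiffVecAt.endo P hσ) (DiffVecAt.endo P hτ),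
      D'.isCovariantDerivativeOnUniv.add (DiffVecAt.endo φ hσ) (DiffVecAt.endo φ hτ),
      mvfderiv_add ((SmoothFormAt.mdifferentiableAt_apply (η.contMDiff x) hσ))
        ((SmoothFormAt.mdifferentiableAt_apply (η.contMDiff x) hτ)), add_apply, add_apply,
      add_apply, map_add, map_add]
    module
  leibniz {σ f x} hσ hf _ := by
    have h₁ : ∀ ψ : EndoField m M, (fun y => ψ y ((f • σ) y)) = f • fun y => ψ y (σ y) :=
      fun ψ => by
        funext y
        simp
    have h₂ : (fun y => η y ((f • σ) y)) = f * fun y => η y (σ y) := by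
      funext y
      simp
    ext v
    rw [add_apply, smul_apply, ContinuousLinearMap.smulRight_apply, twist_apply, twist_apply,
      h₁, h₁, h₂,
      D.isCovariantDerivativeOnUniv.leibniz (DiffVecAt.endo P hσ) hf,
      D'.isCovariantDerivativeOnUniv.leibniz (DiffVecAt.endo φ hσ) hf,
      mvfderiv_mul hf (SmoothFormAt.mdifferentiableAt_apply (η.contMDiff x) hσ)]
    conv_rhs => rw [← h x (σ x)]
    simp only [add_apply, smul_apply, ContinuousLinearMap.smulRight_apply, map_add, map_smul,
      smul_eq_mul]
    module

lemma smoothEndoAt_twist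
    (hD : ∀ σ : ∀ x : M, TangentSpace (𝓡 m) x, (∀ x, SmoothVecAt σ x) → ∀ x, SmoothEndoAt (D σ) x)
    (hD' : ∀ σ : ∀ x : M, TangentSpace (𝓡 m) x, (∀ x, SmoothVecAt σ x) →
      ∀ x, SmoothEndoAt (D' σ) x)
    {σ : ∀ x : M, TangentSpace (𝓡 m) x} (hσ : ∀ x, SmoothVecAt σ x) (x : M) :
    SmoothEndoAt (twist P φ ξ η D D' σ) x :=
  smoothEndoAt_iff.2 fun X hX => by
    simp only [twist_apply]
    refine (SmoothVecAt.smul contMDiffAt_const (.sub (.endo P ?_) (.endo φ ?_))).add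
      (.smul ?_ (ξ.contMDiff x))
    · exact smoothEndoAt_iff.1 (hD _ (fun y => (hσ y).endo P) x) X hX
    · exact smoothEndoAt_iff.1 (hD' _ (fun y => (hσ y).endo φ) x) X hX
    · exact smoothFormAt_iff.1 (smoothFormAt_mvfderiv (smoothFormAt_iff.1 (η.contMDiff x) σ (hσ x)))
        X hX

lemma contMDiffCovariantDerivative_of_smoothEndoAt
    (hD : ∀ σ : ∀ x : M, TangentSpace (𝓡 m) x, (∀ x, SmoothVecAt σ x) →
      ∀ x, SmoothEndoAt (D σ) x) : D.ContMDiffCovariantDerivative ∞ :=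
  ⟨⟨fun {σ} hσ => contMDiffOn_univ.2 (hD σ fun y =>
    ((contMDiffOn_univ.1 hσ) y).of_le le_self_add)⟩⟩

end TwistedConnection

/-! ### From almost contact structures to the gauge equation -/

section AlmostContact

variable {m : ℕ} {M : Type*} [TopologicalSpace M] [ChartedSpace (Model m) M]
  [IsManifold (𝓡 m) ∞ M] {φ : EndoField m M} {ξ : VectorField m M} {η : OneForm m M}

/-- Computing `φ³ v` in two ways gives `η(φ v) ξ = η(v) φ ξ`. Hence `φ ξ = c ξ`, and `φ² ξ = 0`
forces `c² = 0`; the same identity then yields `η ∘ φ = 0`. -/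
lemma IsAlmostContact.apply_reeb (h : IsAlmostContact φ ξ η) (x : M) :
    φ x (ξ x) = 0 ∧ ∀ v, η x (φ x v) = 0 := by
  obtain ⟨h₁, h₂⟩ := h x
  have h₃ : ∀ v, η x (φ x v) • ξ x = η x v • φ x (ξ x) := fun v => by
    have h₄ := congrArg (φ x) (h₂ v)
    rw [h₂ (φ x v), map_add, map_neg, map_smul] at h₄
    exact add_left_cancel h₄
  have h₄ : φ x (ξ x) = η x (φ x (ξ x)) • ξ x := by rw [h₃, h₁, one_smul]
  have hξ : ξ x ≠ 0 := fun h0 => by simp [h0] at h₁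
  have h₅ : η x (φ x (ξ x)) = 0 := by
    have h₆ := h₂ (ξ x)
    rw [h₁, one_smul, neg_add_cancel] at h₆
    have h₇ := congrArg (fun u => η x (φ x (ξ x)) • u) h₄
    have h₈ := congrArg (φ x) h₄
    rw [h₆, map_smul] at h₈
    rw [← h₈] at h₇
    exact mul_self_eq_zero.1 ((smul_eq_zero.1 ((smul_smul _ _ _).symm.trans h₇.symm)).resolve_right
      hξ)
  have h₆ : φ x (ξ x) = 0 := by rw [h₄, h₅, zero_smul]
  refine ⟨h₆, fun v => ?_⟩
  have h₇ := h₃ v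
  rw [h₆, smul_zero] at h₇
  exact (smul_eq_zero.1 h₇).resolve_right hξ

lemma IsAlmostContact.apply_apply_apply (h : IsAlmostContact φ ξ η) (x : M)
    (v : TangentSpace (𝓡 m) x) : φ x (φ x (φ x v)) = -φ x v := by
  rw [(h x).2 (φ x v), (h.apply_reeb x).2, zero_smul, add_zero]

/-- A Riemannian metric compatible with an almost contact structure. -/
lemma IsAlmostContact.exists_metric [T2Space M] [SigmaCompactSpace M]
    (h : IsAlmostContact φ ξ η) :
    ∃ g : Metric m M, IsSkew g φ ∧ ∀ x v, g.inner x (ξ x) v = η x v := by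
  obtain ⟨g₀⟩ := DualConn.exists_metric m M
  let φ2 : ∀ x : M, TangentSpace (𝓡 m) x →L[ℝ] TangentSpace (𝓡 m) x := fun x => (φ x).comp (φ x)
  have hφ2 : ∀ x v, φ2 x v = φ x (φ x v) := fun _ _ => rfl
  -- On `ker η` the sum `g₁ + g₂` is, up to a factor, the average of `g₀` over the cyclic group of
  -- order four generated by `φ`; the `η ⊗ η` term handles `ξ`.
  let g₁ : ∀ x : M, TangentSpace (𝓡 m) x →L[ℝ] TangentSpace (𝓡 m) x →L[ℝ] ℝ := fun x =>
    pullbackBilin (E := Model m) (g₀.inner x) (φ x) (φ x)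
  let g₂ : ∀ x : M, TangentSpace (𝓡 m) x →L[ℝ] TangentSpace (𝓡 m) x →L[ℝ] ℝ := fun x =>
    pullbackBilin (E := Model m) (g₀.inner x) (φ2 x) (φ2 x)
  let g : ∀ x : M, TangentSpace (𝓡 m) x →L[ℝ] TangentSpace (𝓡 m) x →L[ℝ] ℝ := fun x =>
    g₁ x + g₂ x + (η x).smulRight (η x)
  have hg : ∀ x v w, g x v w = g₀.inner x (φ x v) (φ x w) +
      g₀.inner x (φ x (φ x v)) (φ x (φ x w)) + η x v * η x w := fun _ _ _ => rfl
  have hη := fun x => (h.apply_reeb x).2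
  have hξ := fun x => (h.apply_reeb x).1
  have hφ3 := h.apply_apply_apply
  have hgskew : ∀ x v w, g x (φ x v) w = -g x v (φ x w) := fun x v w => by
    rw [hg, hg, hφ3, hφ3, hη, hη, map_neg, map_neg, neg_apply]
    ring
  have hgξ : ∀ x v, g x (ξ x) v = η x v := fun x v => by
    simp only [hg, hξ, map_zero, zero_apply, (h x).1, zero_add, one_mul]
  have hnn : ∀ x v, 0 ≤ g₀.inner x v v := fun x v => by
    by_cases hv : v = 0
    · simp [hv]
    · exact (g₀.pos x v hv).le
  refine ⟨metricOfBilin g (fun x => smoothBilinAt_iff₂.2 fun X Y hX hY => ?_)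
    (fun x v w => ?_) (fun x v hv => ?_), hgskew, hgξ⟩
  · simp only [hg]
    exact ((smoothBilinAt_iff₂.1 (g₀.contMDiff x) _ _ (hX.endo φ) (hY.endo φ)).add
      (smoothBilinAt_iff₂.1 (g₀.contMDiff x) _ _ ((hX.endo φ).endo φ) ((hY.endo φ).endo φ))).add
      ((smoothFormAt_iff.1 (η.contMDiff x) X hX).mul (smoothFormAt_iff.1 (η.contMDiff x) Y hY))
  · rw [hg, hg, g₀.symm, g₀.symm x (φ x (φ x v)), mul_comm]
  · rw [hg]
    have h₁ := hnn x (φ x v)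
    have h₂ := hnn x (φ x (φ x v))
    have h₃ := mul_self_nonneg (η x v)
    by_cases hφv : φ x v = 0
    · have h₄ : η x v ≠ 0 := fun h0 => hv (by
        have h₅ := (h x).2 v
        rw [hφv, map_zero, h0, zero_smul, add_zero] at h₅
        exact neg_eq_zero.1 h₅.symm)
      have := mul_self_pos.2 h₄
      positivity
    · have := g₀.pos x _ hφv
      positivity

/-- If `φ v = 0` then `v = η(v) ξ`, so the kernel is the line spanned by `ξ`. -/
lemma IsAlmostContact.hasConstRank {n : ℕ} {M : Type*} [TopologicalSpace M]
    [ChartedSpace (Model (2 * n + 1)) M] [IsManifold (𝓡 (2 * n + 1)) ∞ M]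
    {φ : EndoField (2 * n + 1) M} {ξ : VectorField (2 * n + 1) M} {η : OneForm (2 * n + 1) M}
    (h : IsAlmostContact φ ξ η) : HasConstRank φ (2 * n) := fun x => by
  have : FiniteDimensional ℝ (TangentSpace (𝓡 (2 * n + 1)) x) :=
    inferInstanceAs (FiniteDimensional ℝ (Model (2 * n + 1)))
  have hξ : ξ x ≠ 0 := fun h0 => by
    have := (h x).1
    simp [h0] at this
  have hker : LinearMap.ker (φ x : TangentSpace (𝓡 (2 * n + 1)) x →ₗ[ℝ]
      TangentSpace (𝓡 (2 * n + 1)) x) =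
      Submodule.span ℝ {ξ x} := by
    ext v
    rw [LinearMap.mem_ker, Submodule.mem_span_singleton]
    constructor
    · intro hv
      have h₁ := (h x).2 v
      have hv : φ x v = 0 := hv
      rw [hv, map_zero] at h₁
      exact ⟨η x v, by rw [← sub_eq_zero, sub_eq_neg_add]; exact h₁.symm⟩
    · rintro ⟨a, rfl⟩
      change φ x (a • ξ x) = 0
      rw [map_smul, (h.apply_reeb x).1, smul_zero]
  have h₁ := LinearMap.finrank_range_add_finrank_ker
    (φ x : TangentSpace (𝓡 (2 * n + 1)) x →ₗ[ℝ] TangentSpace (𝓡 (2 * n + 1)) x)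
  rw [hker, finrank_span_singleton hξ, finrank_tangentSpace] at h₁
  omega

variable {P : EndoField m M} {D D' : Connection m M} {g : Metric m M}

lemma apply_apply_eq_of_eq_neg (h : IsAlmostContact φ ξ η)
    (hP : ∀ x v, P x v = -φ x (φ x v)) (x : M) (v : TangentSpace (𝓡 m) x) :
    P x (P x v) = P x v := by
  rw [hP x v, map_neg, hP, h.apply_apply_apply, neg_neg]

/-- From `φ P = P φ = φ`, `φ² = -P`, `η ∘ φ = 0` and `φ ξ = 0`, both sides become `(P D' (φ Y) + φ D
(P Y)) / 2`. -/
lemma IsAlmostContact.gaugeEquation_twist (h : IsAlmostContact φ ξ η)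
    (hP : ∀ x v, P x v = -φ x (φ x v)) (Y : VectorField m M) (x : M) (v : TangentSpace (𝓡 m) x) :
    twist P φ ξ η D' D (fun y => φ y (Y y)) x v = φ x (twist P φ ξ η D D' Y x v) := by
  have hφ3 := h.apply_apply_apply
  have hPφ : ∀ x v, P x (φ x v) = φ x v := fun x v => by rw [hP, hφ3, neg_neg]
  have hφP : ∀ x v, φ x (P x v) = φ x v := fun x v => by rw [hP, map_neg, hφ3, neg_neg]
  have hd : DiffVecAt (fun y => P y (Y y)) x :=
    DiffVecAt.endo P ((Y.contMDiff x).mdifferentiableAt (by simp))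
  have e₁ : (fun y => P y (φ y (Y y))) = fun y => φ y (Y y) := funext fun y => hPφ y _
  have e₂ : (fun y => φ y (φ y (Y y))) = (-1 : ℝ) • fun y => P y (Y y) := by
    funext y
    simp [hP]
  have e₃ : (fun y => η y (φ y (Y y))) = fun _ => 0 := funext fun y => (h.apply_reeb y).2 _
  have h₁ : D (fun y => φ y (φ y (Y y))) x v = -D (fun y => P y (Y y)) x v := by
    rw [e₂, D.isCovariantDerivativeOnUniv.smul_const (-1) hd, smul_apply, neg_one_smul]
  have h₂ : twist P φ ξ η D' D (fun y => φ y (Y y)) x v =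
      (1 / 2 : ℝ) • (P x (D' (fun y => φ y (Y y)) x v) + φ x (D (fun y => P y (Y y)) x v)) := by
    rw [twist_apply, h₁, e₁, e₃, mvfderiv_const, zero_apply, zero_smul, add_zero, map_neg,
      sub_neg_eq_add]
  rw [h₂, twist_apply, map_add, map_smul, map_sub, map_smul, hφP, (h.apply_reeb x).1, smul_zero,
    add_zero, sub_eq_neg_add, ← hP]

/-- Both `g(P X, P Y)` and `g(φ Y, φ X)` equal `g(X, Y) - η(X) η(Y)`. Averaging the duality of `D,
D'` on these two pairs, with the order reversed in the second, and adding the derivative of `η(X)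
η(Y)` gives the claim. -/
lemma IsAlmostContact.mvfderiv_inner_twist (h : IsAlmostContact φ ξ η)
    (hP : ∀ x v, P x v = -φ x (φ x v)) (hskew : IsSkew g φ)
    (hgξ : ∀ x v, g.inner x (ξ x) v = η x v)
    (hdual : ∀ (X Y : ∀ x : M, TangentSpace (𝓡 m) x) (x : M), SmoothVecAt X x → SmoothVecAt Y x →
      ∀ v, mvfderiv (𝓡 m) (fun y => g.inner y (X y) (Y y)) x v =
        g.inner x (D X x v) (Y x) + g.inner x (X x) (D' Y x v))
    {X Y : ∀ x : M, TangentSpace (𝓡 m) x} {x : M} (hX : SmoothVecAt X x) (hY : SmoothVecAt Y x)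
    (v : TangentSpace (𝓡 m) x) :
    mvfderiv (𝓡 m) (fun y => g.inner y (X y) (Y y)) x v =
      g.inner x (twist P φ ξ η D D' X x v) (Y x) + g.inner x (X x) (twist P φ ξ η D' D Y x v) := by
  have hgP : ∀ x v w, g.inner x (P x v) w = g.inner x v (P x w) := fun x v w => by
    rw [hP, hP, map_neg, map_neg, neg_apply, hskew, hskew, neg_neg]
  have hgφφ : ∀ x v w, g.inner x (φ x v) (φ x w) = g.inner x v w - η x v * η x w :=
    fun x v w => by
      rw [hskew, (h x).2, map_add, map_neg, map_smul, g.symm x v (ξ x), hgξ, smul_eq_mul]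
      ring
  have hgPP : ∀ x v w, g.inner x (P x v) (P x w) = g.inner x v w - η x v * η x w :=
    fun x v w => by
      rw [← hgφφ, hgP, apply_apply_eq_of_eq_neg h hP, hP, map_neg, hskew]
  have hgXY := (smoothBilinAt_iff₂.1 (g.contMDiff x) _ _ hX hY).mdifferentiableAt
    (n := ∞) (by simp)
  have hηX := (smoothFormAt_iff.1 (η.contMDiff x) _ hX).mdifferentiableAt (n := ∞) (by simp)
  have hηY := (smoothFormAt_iff.1 (η.contMDiff x) _ hY).mdifferentiableAt (n := ∞) (by simp)
  have hd : mvfderiv (𝓡 m) ((fun y => g.inner y (X y) (Y y)) -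
      (fun y => η y (X y)) * fun y => η y (Y y)) x v =
      mvfderiv (𝓡 m) (fun y => g.inner y (X y) (Y y)) x v -
        (η x (X x) * mvfderiv (𝓡 m) (fun y => η y (Y y)) x v +
          η x (Y x) * mvfderiv (𝓡 m) (fun y => η y (X y)) x v) := by
    rw [mvfderiv_sub hgXY (hηX.mul hηY), mvfderiv_mul hηX hηY]
    rfl
  have h₁ := hdual _ _ x (hX.endo P) (hY.endo P) v
  have h₂ := hdual _ _ x (hY.endo φ) (hX.endo φ) v
  have e₁ : (fun y => g.inner y (P y (X y)) (P y (Y y))) = (fun y => g.inner y (X y) (Y y)) -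
      (fun y => η y (X y)) * fun y => η y (Y y) := funext fun y => hgPP y _ _
  have e₂ : (fun y => g.inner y (φ y (Y y)) (φ y (X y))) = (fun y => g.inner y (X y) (Y y)) -
      (fun y => η y (X y)) * fun y => η y (Y y) :=
    funext fun y => (g.symm y _ _).trans (hgφφ y _ _)
  rw [e₁, hd] at h₁
  rw [e₂, hd, g.symm x _ (φ x (X x)), g.symm x (φ x (Y x))] at h₂
  have h₃ : g.inner x (twist P φ ξ η D D' X x v) (Y x) =
      1 / 2 * (g.inner x (D (fun y => P y (X y)) x v) (P x (Y x)) +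
        g.inner x (D' (fun y => φ y (X y)) x v) (φ x (Y x))) +
      mvfderiv (𝓡 m) (fun y => η y (X y)) x v * η x (Y x) := by
    rw [twist_apply, map_add, map_smul, map_sub, map_smul, add_apply, smul_apply, smul_apply,
      sub_apply, hgP, hskew, hgξ, sub_neg_eq_add, smul_eq_mul, smul_eq_mul]
  have h₄ : g.inner x (X x) (twist P φ ξ η D' D Y x v) =
      1 / 2 * (g.inner x (P x (X x)) (D' (fun y => P y (Y y)) x v) +
        g.inner x (φ x (X x)) (D (fun y => φ y (Y y)) x v)) +
      mvfderiv (𝓡 m) (fun y => η y (Y y)) x v * η x (X x) := by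
    rw [twist_apply, map_add, map_smul, map_sub, map_smul, g.symm x (X x) (ξ x), hgP, hskew,
      hgξ, sub_eq_add_neg, smul_eq_mul, smul_eq_mul]
  rw [h₃, h₄]
  linarith

/-- An almost contact structure solves the gauge equation of some pair of dual connections. -/
theorem exists_gaugeEquation_of_almostContact [T2Space M] [SigmaCompactSpace M]
    (h : IsAlmostContact φ ξ η) :
    ∃ (g : Metric m M) (nabla nabla' : Connection m M),
      nabla.ContMDiffCovariantDerivative ∞ ∧ nabla'.ContMDiffCovariantDerivative ∞ ∧
      AreDual g nabla nabla' ∧ GaugeEquation nabla nabla' φ ∧ IsSkew g φ := by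
  obtain ⟨g, hskew, hgξ⟩ := h.exists_metric
  obtain ⟨D, D', hD, hD', hdual⟩ := exists_dual_connections g
  -- `P = Id - η ⊗ ξ` is the projection onto `ker η` along `ξ`.
  let P : EndoField m M := ⟨fun x => -(φ x).comp (φ x), fun x => smoothEndoAt_iff.2 fun X hX => by
    have := SmoothVecAt.smul (f := fun _ => -1) contMDiffAt_const ((hX.endo φ).endo φ)
    simpa using this⟩
  have hP : ∀ x v, P x v = -φ x (φ x v) := fun _ _ => rfl
  have hId : ∀ x v, (1 / 2 : ℝ) • (P x (P x v) - φ x (φ x v)) + η x v • ξ x = v := fun x v => by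
    rw [apply_apply_eq_of_eq_neg h hP, hP, (h x).2]
    module
  exact ⟨g, ⟨_, isCovariantDerivativeOn_twist (D := D) (D' := D') hId⟩,
    ⟨_, isCovariantDerivativeOn_twist (D := D') (D' := D) hId⟩,
    contMDiffCovariantDerivative_of_smoothEndoAt fun σ hσ => smoothEndoAt_twist hD hD' hσ,
    contMDiffCovariantDerivative_of_smoothEndoAt fun σ hσ => smoothEndoAt_twist hD' hD hσ,
    fun X Y Z x => h.mvfderiv_inner_twist hP hskew hgξ hdual (X.contMDiff x) (Y.contMDiff x) (Z x),
    fun X Y x => h.gaugeEquation_twist hP Y x (X x), hskew⟩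

end AlmostContact

end DualConn

end

noncomputable section

namespace DualConn

/-! ### Orientation through determinants of charts -/

section ChartDet

variable {m : ℕ} {M : Type*} [TopologicalSpace M] [ChartedSpace (Model m) M]

/-- The determinant form of a chart. -/
def chartDet (e : OpenPartialHomeomorph M (Model m)) (x : M) :
    TangentSpace (𝓡 m) x [⋀^Fin m]→ₗ[ℝ] ℝ :=
  (EuclideanSpace.basisFun (Fin m) ℝ).toBasis.det.compLinearMap (mvfderiv (𝓡 m) e x).toLinearMap

lemma chartDet_apply (e : OpenPartialHomeomorph M (Model m)) (x : M)
    (v : Fin m → TangentSpace (𝓡 m) x) :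
    chartDet e x v =
      (EuclideanSpace.basisFun (Fin m) ℝ).toBasis.det (fun j => mvfderiv (𝓡 m) e x (v j)) :=
  rfl

variable {e e' : OpenPartialHomeomorph M (Model m)} {x : M}

lemma mdifferentiable_of_mem_maximalAtlas (he : e ∈ IsManifold.maximalAtlas (𝓡 m) ∞ M) :
    e.MDifferentiable (𝓡 m) (𝓡 m) :=
  ⟨(contMDiffOn_of_mem_maximalAtlas he).mdifferentiableOn (by simp),
    (contMDiffOn_symm_of_mem_maximalAtlas he).mdifferentiableOn (by simp)⟩

/-- The determinant forms of two charts differ by the Jacobian determinant of the transition. -/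
lemma chartDet_eq_det_mul (he : e ∈ IsManifold.maximalAtlas (𝓡 m) ∞ M)
    (he' : e' ∈ IsManifold.maximalAtlas (𝓡 m) ∞ M) (hx : x ∈ e.source) (hx' : x ∈ e'.source)
    (v : Fin m → TangentSpace (𝓡 m) x) :
    chartDet e' x v = (fderiv ℝ (e.symm.trans e') (e x)).det * chartDet e x v := by
  have hd := mdifferentiable_of_mem_maximalAtlas he
  have hd' := mdifferentiable_of_mem_maximalAtlas he'
  have hex : e x ∈ (e.symm.trans e').source := by
    simp [e.map_source hx, e.left_inv hx, hx']
  have h₁ : mfderiv (𝓡 m) (𝓡 m) e' x =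
      (mfderiv (𝓡 m) (𝓡 m) (e.symm.trans e') (e x)).comp (mfderiv (𝓡 m) (𝓡 m) e x) := by
    rw [← mfderiv_comp x ((hd.symm.trans hd').mdifferentiableAt hex) (hd.mdifferentiableAt hx)]
    refine Filter.EventuallyEq.mfderiv_eq ?_
    filter_upwards [e.open_source.mem_nhds hx] with y hy
    simp [e.left_inv hy]
  rw [chartDet_apply, chartDet_apply, ContinuousLinearMap.det, ← Module.Basis.det_comp]
  congr 1
  funext j
  have h₂ := congrArg (fun L => L (v j)) h₁
  rw [mfderiv_eq_fderiv] at h₂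
  exact h₂

lemma exists_basis_chartDet_pos (he : e ∈ IsManifold.maximalAtlas (𝓡 m) ∞ M) (hx : x ∈ e.source) :
    ∃ v, 0 < chartDet e x v := by
  have hd := mdifferentiable_of_mem_maximalAtlas he
  choose v hv using fun j : Fin m =>
    hd.mfderiv_surjective hx ((EuclideanSpace.basisFun (Fin m) ℝ).toBasis j)
  refine ⟨v, ?_⟩
  rw [chartDet_apply]
  have h : (fun j => mvfderiv (𝓡 m) e x (v j)) = (EuclideanSpace.basisFun (Fin m) ℝ).toBasis :=
    funext hv
  rw [h, Module.Basis.det_self]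
  exact one_pos

variable [IsManifold (𝓡 m) ∞ M]

lemma contMDiffAt_chartDet (he : e ∈ IsManifold.maximalAtlas (𝓡 m) ∞ M) (hx : x ∈ e.source)
    {E : Fin m → ∀ x : M, TangentSpace (𝓡 m) x} (hE : ∀ j, SmoothVecAt (E j) x) :
    ContMDiffAt (𝓡 m) 𝓘(ℝ) ∞ (fun y => chartDet e y fun j => E j y) x := by
  simp only [chartDet_apply, Module.Basis.det_apply, Matrix.det_apply']
  refine contMDiffAt_finsetSum fun σ _ =>
    contMDiffAt_const.mul (contMDiffAt_finsetProd fun j _ => ?_)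
  have hd := mdifferentiable_of_mem_maximalAtlas he
  let p : EuclideanSpace ℝ (Fin m) →L[ℝ] ℝ := EuclideanSpace.proj (σ j)
  have h₁ : ContMDiffAt (𝓡 m) 𝓘(ℝ) ∞ (fun y => p (e y)) x :=
    p.contMDiff.contMDiffAt.comp x (contMDiffAt_of_mem_maximalAtlas he hx)
  refine (smoothFormAt_iff.1 (smoothFormAt_mvfderiv h₁) _ (hE j)).congr_of_eventuallyEq ?_
  filter_upwards [e.open_source.mem_nhds hx] with y hy
  have h₂ := (p.hasMFDerivAt.comp y (hd.mdifferentiableAt hy).hasMFDerivAt).mfderiv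
  exact (congrArg (fun L => L (E j y)) h₂).symm

end ChartDet

/-! ### From skew endomorphisms of rank `2n` to almost cosymplectic structures -/

section Coorientation

/-- A skew map of rank `2 n` defines a 2-form whose Pfaffian vector does not vanish. -/
lemma pfaffianVector_basis_ne_zero {n : ℕ} {V : Type*} [AddCommGroup V] [Module ℝ V]
    (b : Module.Basis (Fin (2 * n + 1)) ℝ V)
    {g : V →ₗ[ℝ] V →ₗ[ℝ] ℝ} (hsymm : ∀ v w, g v w = g w v) (hpos : ∀ v, v ≠ 0 → 0 < g v v)
    {θ : V →ₗ[ℝ] V} (hskew : ∀ v w, g (θ v) w = -g v (θ w))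
    (hrank : Module.finrank ℝ (LinearMap.range θ) = 2 * n)
    {Ω : V →ₗ[ℝ] V →ₗ[ℝ] ℝ} (hΩ : ∀ v w, Ω v w = g (θ v) w) : pfaffianVector n Ω b ≠ 0 := by
  have hV : Module.finrank ℝ V = 2 * n + 1 := by
    rw [Module.finrank_eq_card_basis b, Fintype.card_fin]
  have hfd : FiniteDimensional ℝ V := FiniteDimensional.of_finrank_pos (by omega)
  have h0 : ∀ v, g v v = 0 → v = 0 := fun v hv => by
    by_contra hne
    exact (hpos v hne).ne' hv
  have hker : Module.finrank ℝ (LinearMap.ker θ) = 1 := by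
    have := θ.finrank_range_add_finrank_ker
    omega
  obtain ⟨⟨k, hkθ⟩, hk, hspan⟩ := finrank_eq_one_iff'.1 hker
  have hkθ : θ k = 0 := hkθ
  have hk : k ≠ 0 := fun h => hk (Subtype.ext h)
  -- With `k` spanning `ker θ`, the auxiliary 1-form is `g(k, ·)`. For nondegeneracy on its kernel,
  -- test `u` against `w = θ u`, which is orthogonal to `k` by skewness: this gives `g(θ u, θ u) =
  -- 0`, so `u` is a multiple of `k` orthogonal to `k`.
  obtain ⟨v, hv⟩ := exists_wedgePowWedge_ne_zero hV (Ω := Ω) (η := g k) (fun v => by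
    have h₁ := hskew v v
    rw [hsymm v] at h₁
    rw [hΩ]
    linarith) (fun h => hk (h0 k (by rw [h, LinearMap.zero_apply]))) fun u hu hw => by
      have h₁ : θ u = 0 := by
        refine h0 _ ?_
        rw [← hΩ]
        refine hw _ ?_
        rw [hsymm, hskew, hkθ, map_zero, neg_zero]
      obtain ⟨c, hc⟩ := hspan ⟨u, h₁⟩
      have hc : c • k = u := congrArg Subtype.val hc
      rw [← hc, map_smul, smul_eq_mul] at hu
      rcases mul_eq_zero.1 hu with h | h
      · rw [← hc, h, zero_smul]
      · exact absurd (h0 k h) hk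
  rw [wedgePowWedge_eq, pfaffianVector_eq_det_smul n Ω b v] at hv
  exact fun h => hv (by rw [h, smul_zero, map_zero])

variable {n : ℕ} {M : Type*} [TopologicalSpace M] [ChartedSpace (Model (2 * n + 1)) M]
  [IsManifold (𝓡 (2 * n + 1)) ∞ M]

lemma smoothVecAt_pfaffianVector {Ω : BilinField (2 * n + 1) M} {x : M}
    {E : Fin (2 * n + 1) → ∀ x : M, TangentSpace (𝓡 (2 * n + 1)) x}
    (hE : ∀ j, SmoothVecAt (E j) x) :
    SmoothVecAt (fun y => pfaffianVector n (bilinOfCLM (Ω y)) fun j => E j y) x := by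
  simp only [pfaffianVector_apply]
  refine SmoothVecAt.smul contMDiffAt_const (ContMDiffAt.sum_section fun σ _ =>
    SmoothVecAt.smul (contMDiffAt_const.mul (contMDiffAt_finsetProd fun i _ => ?_)) (hE _))
  exact smoothBilinAt_iff₂.1 (Ω.contMDiff x) _ _ (hE _) (hE _)

set_option synthInstance.maxHeartbeats 100000 in
/-- On an oriented manifold, a 2-form with nowhere vanishing Pfaffian vector has a smooth 1-form
which is positive on the Pfaffian vectors of positive frames. -/
lemma exists_oneForm_pos [T2Space M] [SigmaCompactSpace M] (hM : Orientable (2 * n + 1) M)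
    (g : Metric (2 * n + 1) M) (Ω : BilinField (2 * n + 1) M)
    (hΩ : ∀ x (b : Module.Basis (Fin (2 * n + 1)) ℝ (TangentSpace (𝓡 (2 * n + 1)) x)),
      pfaffianVector n (bilinOfCLM (Ω x)) b ≠ 0) :
    ∃ η : OneForm (2 * n + 1) M, ∀ x, ∃ v, 0 < η x (pfaffianVector n (bilinOfCLM (Ω x)) v) := by
  obtain ⟨A, hA, hcover, hdet⟩ := hM
  obtain ⟨s, hs⟩ := exists_contMDiffSection_forall_mem_convex_of_local (n := (⊤ : ℕ∞))
    (𝓡 (2 * n + 1)) (F_fiber := Model (2 * n + 1) →L[ℝ] ℝ)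
    (fun x : M => TangentSpace (𝓡 (2 * n + 1)) x →L[ℝ] ℝ)
    (fun x => {α | ∀ e ∈ A, x ∈ e.source → ∀ v, 0 < chartDet e x v →
      0 < α (pfaffianVector n (bilinOfCLM (Ω x)) v)})
    (fun x α₁ h₁ α₂ h₂ s t hs ht hst e he hx v hv => by
      have h₁' := h₁ e he hx v hv
      have h₂' := h₂ e he hx v hv
      rcases hs.eq_or_lt with rfl | hs
      · rw [zero_add] at hst
        simpa [hst] using h₂'
      · simp only [add_apply, smul_apply, smul_eq_mul]
        positivity)
    (fun x₀ => by
      obtain ⟨e₀, he₀, hx₀⟩ := hcover x₀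
      obtain ⟨β, E, U, hU, hxU, -, hE, hβE⟩ := exists_frame (2 * n + 1) x₀
      refine ⟨U ∩ e₀.source, Filter.inter_mem (hU.mem_nhds hxU) (e₀.open_source.mem_nhds hx₀),
        -- The frame `E` need not be positive; the factor `chartDet` corrects the sign. On the
        -- Pfaffian vector of `v` this form takes the value `chartDet e₀ x v` times the squared
        -- length of the Pfaffian vector of `E`.
        fun x => chartDet e₀ x (fun j => E j x) •
          g.inner x (pfaffianVector n (bilinOfCLM (Ω x)) fun j => E j x), fun x hx => ?_,
        fun x hx e he hxe v hv => ?_⟩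
      · refine ContMDiffAt.contMDiffWithinAt (ContMDiffAt.smul_section
          (contMDiffAt_chartDet (hA he₀) hx.2 (hE x hx.1))
          (smoothBilinAt_iff.1 (g.contMDiff x) _ (smoothVecAt_pfaffianVector (hE x hx.1))))
      · have hspan : ⊤ ≤ Submodule.span ℝ (Set.range fun j => E j x) := fun u _ => by
          rw [← hβE x hx.1 u]
          exact Submodule.sum_mem _ fun j _ =>
            Submodule.smul_mem _ _ (Submodule.subset_span ⟨j, rfl⟩)
        let b := basisOfTopLeSpanOfCardEqFinrank (fun j => E j x) hspan (by
          rw [finrank_tangentSpace, Fintype.card_fin])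
        have hb : ⇑b = fun j => E j x := coe_basisOfTopLeSpanOfCardEqFinrank _ _ _
        -- Positive transition Jacobians make positivity of a frame independent of the chart in `A`.
        have hv₀ : 0 < chartDet e₀ x v := by
          rw [chartDet_eq_det_mul (hA he) (hA he₀) hxe hx.2]
          refine mul_pos (hdet e he e₀ he₀ _ ?_) hv
          simp [e.map_source hxe, e.left_inv hxe, hx.2]
        have h₁ : chartDet e₀ x v = chartDet e₀ x b * b.det v := by
          conv_lhs => rw [(chartDet e₀ x).eq_smul_basis_det b]
          rfl
        beta_reduce
        rw [← hb, smul_apply, pfaffianVector_eq_det_smul n _ b v, map_smul, smul_eq_mul,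
          smul_eq_mul, ← mul_assoc, ← h₁]
        exact mul_pos hv₀ (g.pos x _ (hΩ x b)))
  refine ⟨s, fun x => ?_⟩
  obtain ⟨e, he, hx⟩ := hcover x
  obtain ⟨v, hv⟩ := exists_basis_chartDet_pos (hA he) hx
  exact ⟨v, hs x e he hx v hv⟩

/-- A skew field of endomorphisms of rank `2 n` on an orientable manifold defines an almost
cosymplectic structure. -/
theorem exists_almostCosymplectic_of_isSkew [T2Space M] [SigmaCompactSpace M]
    (hM : Orientable (2 * n + 1) M) {g : Metric (2 * n + 1) M} {θ : EndoField (2 * n + 1) M}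
    (hskew : IsSkew g θ) (hrank : HasConstRank θ (2 * n)) :
    ∃ (Ω : TwoForm (2 * n + 1) M) (η : OneForm (2 * n + 1) M), IsAlmostCosymplectic Ω η := by
  let Ω : TwoForm (2 * n + 1) M :=
    { toField := ⟨fun x => (g.inner x).comp (θ x), fun x => smoothBilinAt_iff.2 fun X hX =>
        smoothBilinAt_iff.1 (g.contMDiff x) _ (hX.endo θ)⟩
      alt := fun x v => by
        have h₁ := hskew x v v
        rw [g.symm x v] at h₁
        change g.inner x (θ x v) v = 0
        linarith }
  obtain ⟨η, hη⟩ := exists_oneForm_pos hM g Ω.toField fun x b =>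
    pfaffianVector_basis_ne_zero b (g := bilinOfCLM (g.inner x)) (θ := (θ x).toLinearMap)
      (g.symm x) (g.pos x) (hskew x) (hrank x) fun _ _ => rfl
  refine ⟨Ω, η, fun x => ?_⟩
  obtain ⟨v, hv⟩ := hη x
  refine ⟨v, ?_⟩
  have h := wedgePowWedge_eq n (bilinOfCLM (Ω.toField x)) (η x).toLinearMap v
  exact (h.trans_gt hv).ne'

end Coorientation

end DualConn

end

/-! ### The equivalence -/

theorem mainTheorem1 (n : ℕ) (M : Type*) [TopologicalSpace M] [T2Space M]
    [SecondCountableTopology M] [ChartedSpace (EuclideanSpace ℝ (Fin (2 * n + 1))) M]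
    [IsManifold (𝓡 (2 * n + 1)) ∞ M] (hM : DualConn.Orientable (2 * n + 1) M) :
    List.TFAE [
      ∃ (Ω : DualConn.TwoForm (2 * n + 1) M) (η : DualConn.OneForm (2 * n + 1) M),
        DualConn.IsAlmostCosymplectic Ω η,
      ∃ (φ : DualConn.EndoField (2 * n + 1) M) (ξ : DualConn.VectorField (2 * n + 1) M)
        (η : DualConn.OneForm (2 * n + 1) M), DualConn.IsAlmostContact φ ξ η,
      ∃ (g : DualConn.Metric (2 * n + 1) M) (nabla nabla' : DualConn.Connection (2 * n + 1) M),
        nabla.ContMDiffCovariantDerivative ∞ ∧ nabla'.ContMDiffCovariantDerivative ∞ ∧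
        DualConn.AreDual g nabla nabla' ∧
        ∃ θ : DualConn.EndoField (2 * n + 1) M,
          DualConn.GaugeEquation nabla nabla' θ ∧ DualConn.IsSkew g θ ∧
          DualConn.HasConstRank θ (2 * n)] := by
  -- Together with second countability this gives σ-compactness, on which the partitions of unity
  -- rely.
  have : LocallyCompactSpace M :=
    ChartedSpace.locallyCompactSpace (EuclideanSpace ℝ (Fin (2 * n + 1))) M
  tfae_have 1 → 2 := fun ⟨_, η, h⟩ =>
    let ⟨φ, ξ, h'⟩ := DualConn.exists_almostContact_of_almostCosymplectic h
    ⟨φ, ξ, η, h'⟩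
  tfae_have 2 → 3 := fun ⟨φ, _, _, h⟩ =>
    let ⟨g, D, D', hD, hD', hdual, hgauge, hskew⟩ :=
      DualConn.exists_gaugeEquation_of_almostContact h
    ⟨g, D, D', hD, hD', hdual, φ, hgauge, hskew, h.hasConstRank⟩
  tfae_have 3 → 1 := fun ⟨_, _, _, _, _, _, _, _, hskew, hrank⟩ =>
    DualConn.exists_almostCosymplectic_of_isSkew hM hskew hrank
  tfae_finish
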